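/- Let $\{f(\cdot;\theta):\theta\in[\theta_{\min},\theta_{\max}]\}$ be probability densities with respect to a fixed measure on a measurable space, and let $x_0,x_1,\dots$ be independent observations with common density $f(\cdot;\bar\theta)$. Put $f(x_0,\dots,x_{N-1};\theta)=\prod_{n<N}f(x_n;\theta)$. Expectations $\mathbb E$ and probabilities $P$ are taken under the true value $\bar\theta$. Assume: - (A0) $\bar\theta\in(\theta_{\min},\theta_{\max})$. - (A1) For $f(\cdot;\bar\theta)$-almost every $x$, $f(x;\theta)>0$ for all $\theta\in[\theta_{\min},\theta_{\max}]$, and $\theta\mapsto\ln f(x;\theta)$ is three times continuously differentiable on $[\theta_{\min},\theta_{\max}]$ (one-sided derivatives at the end points). - (A2) There are functions $b_0,b_1,b_2,b_3$ of $x$ alone, with finite variance under $f(\cdot;\bar\theta)$, such that for $f(\cdot;\bar\theta)$-almost every $x$, $\left|\frac{\partial^i}{\partial\theta^i}\ln f(x;\theta)\right|\le b_i(x)$ for all $\theta\in[\theta_{\min},\theta_{\max}]$ and $i=0,1,2,3$. - (A3) The Kullback–Leibler divergence $D(\theta)=\int f(x;\bar\theta)\ln\frac{f(x;\bar\theta)}{f(x;\theta)}\,dx$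 has a unique minimum over $[\theta_{\min},\theta_{\max}]$ at $\theta=\bar\theta$. - (A4) $\mathbb E\left[\frac{\partial^2}{\partial\theta^2}\ln f(x;\bar\theta)\right]\neq 0$. Let $\hat\theta_N$ be a maximum likelihood estimator, that is, a measurable function of $x_0,\dots,x_{N-1}$ that almost surely maximizes $f(x_0,\dots,x_{N-1};\theta)$ over $\theta\in[\theta_{\min},\theta_{\max}]$. Let $\operatorname{MSE}_N=\mathbb E[(\hat\theta_N-\bar\theta)^2]$ be its true MSE, let $$\widehat{\operatorname{MSE}}_N=2\int_{(\theta_{\min}-\bar\theta)/2}^{(\theta_{\max}-\bar\theta)/2}|\epsilon|\,P\!\left(\frac{f(x_0,\dots,x_{N-1};\bar\theta+2\epsilon)}{f(x_0,\dots,x_{N-1};\bar\theta)}\ge1\right)d\epsilon$$ be its finite-support predicted MSE, and let $\mathcal I(\bar\theta)=\mathbb E\left[\left(\frac{\partial}{\partial\theta}\ln f(x;\bar\theta)\right)^2\right]$ be the Fisher information of one observation. Then: 1. The integral defining $\widehat{\operatorname{MSE}}_N$ converges for every $N$, and $\hat\theta_N\to\bar\theta$ almost surely as $N\to\infty$. 2.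 The predicted MSE converges to the true large-sample MSE: $N\operatorname{MSE}_N$ and $N\,\widehat{\operatorname{MSE}}_N$ converge, as $N\to\infty$, to the same finite limit; and if $\mathcal I(\bar\theta)>0$, then $\widehat{\operatorname{MSE}}_N/\operatorname{MSE}_N\to1$. 3. If moreover $\hat\theta_N$ is asymptotically efficient, that is, $\mathcal I(\bar\theta)>0$ and $N\operatorname{MSE}_N\to\mathcal I(\bar\theta)^{-1}$, then the predicted MSE converges to the CRLB, the inverse Fisher information: $N\,\widehat{\operatorname{MSE}}_N\to\mathcal I(\bar\theta)^{-1}$. -/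

import Mathlib

open MeasureTheory ProbabilityTheory Filter Topology Set

noncomputable section

/-- The distribution of one observation: the measure with density `f θ` with respect to `μ`. -/
def obsLaw {S : Type*} [MeasurableSpace S] (μ : Measure S) (f : ℝ → S → ℝ) (θ : ℝ) : Measure S :=
  μ.withDensity (fun x => ENNReal.ofReal (f θ x))

/-- `f θ`, for `θ ∈ Θ`, are probability densities with respect to `μ`. -/
structure IsDensityFamily {S : Type*} [MeasurableSpace S] (μ : Measure S) (f : ℝ → S → ℝ)
    (Θ : Set ℝ) : Prop where
  measurable : ∀ θ ∈ Θ, Measurable (f θ)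
  nonneg : ∀ θ ∈ Θ, ∀ x, 0 ≤ f θ x
  lintegral_eq_one : ∀ θ ∈ Θ, ∫⁻ x, ENNReal.ofReal (f θ x) ∂μ = 1

/-- The `i`-th derivative in `θ` of `ln f(x; θ)`, relative to the parameter set `Θ` (one-sided at
the end points when `Θ` is a closed interval; for `i = 0` it is `ln f(x; θ)` itself). -/
def logDensityDeriv {S : Type*} (f : ℝ → S → ℝ) (Θ : Set ℝ) (i : ℕ) (θ : ℝ) (x : S) : ℝ :=
  iteratedDerivWithin i (fun t => Real.log (f t x)) Θ θ

/-- The Kullback-Leibler divergence `D(f(x; θ₀) || f(x; θ))`. -/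
def klDensity {S : Type*} [MeasurableSpace S] (μ : Measure S) (f : ℝ → S → ℝ) (θ₀ θ : ℝ) : ℝ :=
  ∫ x, f θ₀ x * Real.log (f θ₀ x / f θ x) ∂μ

/-- The Fisher information of one observation at `θ₀`: the expected squared score. -/
def fisherInformation {S : Type*} [MeasurableSpace S] (μ : Measure S) (f : ℝ → S → ℝ)
    (Θ : Set ℝ) (θ₀ : ℝ) : ℝ :=
  ∫ x, (logDensityDeriv f Θ 1 θ₀ x) ^ 2 ∂(obsLaw μ f θ₀)

/-- The likelihood of `N` independent observations. -/
def likelihood {S : Type*} (f : ℝ → S → ℝ) {N : ℕ} (x : Fin N → S) (θ : ℝ) : ℝ :=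
  ∏ n, f θ (x n)

/-- The vector of the first `N` observations. -/
def sample {S Ω : Type*} (X : ℕ → Ω → S) (N : ℕ) (ω : Ω) : Fin N → S :=
  fun n => X n ω

/-- `est N` is, for every sample size `N`, a measurable function of the first `N` observations and
almost surely a maximizer over `Θ` of their likelihood. -/
def IsMLE {S Ω : Type*} [MeasurableSpace S] [MeasurableSpace Ω] (P : Measure Ω) (X : ℕ → Ω → S)
    (f : ℝ → S → ℝ) (Θ : Set ℝ) (est : (N : ℕ) → (Fin N → S) → ℝ) : Prop :=
  ∀ N, Measurable (est N) ∧
    ∀ᵐ ω ∂P, est N (sample X N ω) ∈ Θ ∧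
      IsMaxOn (likelihood f (sample X N ω)) Θ (est N (sample X N ω))

/-- The true mean square error of the estimator for sample size `N`. -/
def trueMSE {S Ω : Type*} [MeasurableSpace Ω] (P : Measure Ω) (X : ℕ → Ω → S)
    (est : (N : ℕ) → (Fin N → S) → ℝ) (θ₀ : ℝ) (N : ℕ) : ℝ :=
  ∫ ω, (est N (sample X N ω) - θ₀) ^ 2 ∂P

/-- The integrand `|ε| P(f(x; θ₀ + 2ε) / f(x; θ₀) ≥ 1)` of the predicted mean square error, for
sample size `N`. -/
def predictedMSEIntegrand {S Ω : Type*} [MeasurableSpace Ω] (P : Measure Ω) (X : ℕ → Ω → S)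
    (f : ℝ → S → ℝ) (θ₀ : ℝ) (N : ℕ) (ε : ℝ) : ℝ :=
  |ε| * P.real {ω | likelihood f (sample X N ω) (θ₀ + 2 * ε) /
    likelihood f (sample X N ω) θ₀ ≥ 1}

/-- The finite-support predicted mean square error of the maximum likelihood estimator for
sample size `N` and parameter set `[θmin, θmax]`. -/
def predictedMSE {S Ω : Type*} [MeasurableSpace Ω] (P : Measure Ω) (X : ℕ → Ω → S)
    (f : ℝ → S → ℝ) (θmin θmax θ₀ : ℝ) (N : ℕ) : ℝ :=
  2 * ∫ ε in ((θmin - θ₀) / 2)..((θmax - θ₀) / 2), predictedMSEIntegrand P X f θ₀ N ε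

/-- Asymptotic efficiency at `θ₀`: the Fisher information of one observation is positive, and the
mean square error is asymptotically the Cramer-Rao lower bound `1 / (N * I(θ₀))` of `N`
observations. -/
def AsymptoticallyEfficient {S Ω : Type*} [MeasurableSpace S] [MeasurableSpace Ω]
    (μ : Measure S) (P : Measure Ω) (X : ℕ → Ω → S) (f : ℝ → S → ℝ) (Θ : Set ℝ)
    (est : (N : ℕ) → (Fin N → S) → ℝ) (θ₀ : ℝ) : Prop :=
  0 < fisherInformation μ f Θ θ₀ ∧
    Tendsto (fun N : ℕ => (N : ℝ) * trueMSE P X est θ₀ N) atTop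
      (𝓝 (fisherInformation μ f Θ θ₀)⁻¹)

end

/-! Let `s` be the mean score at `θ₀` over the sample and `J` minus the expected second derivative
of the log-density. By A3, `θ₀` is an interior maximum of the expected log-density, so the score has
mean zero and, with A4, `J > 0`. Taylor expansion with the bound `b 3` shows that, outside
exceptional events, the mean log-likelihood ratio at `θ₀ + t` is `s t - J t² / 2` up to `η t² / 2`
for `|t| ≤ δ`, and is negative for `|t| ≥ δ` (`exists_rare_parabola`).

Both errors are then read off the same parabola. The maximizer solves the score equation, so its
squared error is about `s² / J²`. After exchanging expectation and integral, the predicted error is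
the expectation of twice the integral of `|ε|` over the set where the ratio at `2 ε` is nonnegative.
That set is nearly the interval between `0` and `s / J`, which again gives `s² / J²`
(`superlevel_integral_sandwich`). Hence both errors, multiplied by `N`, tend to the score variance
over `J²` (`tendsto_mul_integral_of_sandwich`). The identity between `J` and the Fisher information
is never needed: under efficiency, uniqueness of limits identifies the common value.

The delicate point is that expectations are multiplied by `N` while only second moments are
available. Chebyshev makes the exceptional events `O(1 / N)`, but `o(1 / N)` is required. Uniform
integrability of the normalized squared sums (`tendsto_setIntegral_centredSum_sq`) supplies this,
and also controls the part of `N s²` lost on those events. -/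

/-! ### Centred sums of independent square-integrable variables -/

/-- The sum of the first `N` variables, centred by the mean of the zeroth one. -/
noncomputable def centredSum {Ω : Type*} [MeasurableSpace Ω] (P : Measure Ω) (Y : ℕ → Ω → ℝ) (N : ℕ) (ω : Ω) :
    ℝ :=
  ∑ i ∈ Finset.range N, (Y i ω - ∫ ω', Y 0 ω' ∂P)

/-- A sequence of independent, identically distributed, square-integrable real variables. -/
structure IIDSquareIntegrable {Ω : Type*} [MeasurableSpace Ω] (P : Measure Ω) (Y : ℕ → Ω → ℝ) :
    Prop where
  indep : iIndepFun Y P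
  ident : ∀ n, IdentDistrib (Y n) (Y 0) P P
  memLp : MemLp (Y 0) 2 P

/-- A single term of the exponential series, with `24 = 4!`; adding both signs removes the case
distinction. It turns bounds on moment generating functions into fourth-moment bounds. -/
theorem pow_four_le_exp (x : ℝ) : x ^ 4 ≤ 24 * (Real.exp x + Real.exp (-x)) := by
  have key : ∀ y : ℝ, 0 ≤ y → y ^ 4 ≤ 24 * Real.exp y := fun y hy => by
    have := Real.pow_div_factorial_le_exp y hy 4
    norm_num [Nat.factorial] at this
    linarith
  rcases le_total 0 x with hx | hx
  · linarith [key x hx, Real.exp_pos (-x)]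
  · have := key (-x) (by linarith)
    have h4 : (-x) ^ 4 = x ^ 4 := by ring
    linarith [Real.exp_pos x]

namespace IIDSquareIntegrable

variable {Ω : Type*} [MeasurableSpace Ω] {P : Measure Ω} {Y : ℕ → Ω → ℝ}

theorem memLp_all (h : IIDSquareIntegrable P Y) (n : ℕ) : MemLp (Y n) 2 P :=
  (h.ident n).symm.memLp_iff.1 h.memLp

theorem comp (h : IIDSquareIntegrable P Y) {g : ℝ → ℝ} (hg : Measurable g)
    (hg2 : MemLp (fun ω => g (Y 0 ω)) 2 P) : IIDSquareIntegrable P (fun n ω => g (Y n ω)) where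
  indep := h.indep.comp (fun _ => g) (fun _ => hg)
  ident n := (h.ident n).comp hg
  memLp := hg2

/-- Truncation at a high level changes a square-integrable variable little in mean square. -/
theorem exists_truncation (h : IIDSquareIntegrable P Y) {ε : ℝ} (hε : 0 < ε) :
    ∃ k : ℕ, ∫ ω, (Y 0 ω - max (-(k : ℝ)) (min k (Y 0 ω))) ^ 2 ∂P < ε := by
  have hlim : Tendsto (fun k : ℕ => ∫ ω, (Y 0 ω - max (-(k : ℝ)) (min k (Y 0 ω))) ^ 2 ∂P) atTop
      (𝓝 (∫ _, (0 : ℝ) ∂P)) := by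
    have hm := h.memLp.aestronglyMeasurable.aemeasurable
    refine tendsto_integral_of_dominated_convergence (fun ω => (Y 0 ω) ^ 2) (fun k => ?_)
      h.memLp.integrable_sq (fun k => ae_of_all _ fun ω => ?_) (ae_of_all _ fun ω => ?_)
    · exact ((hm.sub (aemeasurable_const.max (aemeasurable_const.min hm))).pow_const 2
        ).aestronglyMeasurable
    · rw [Real.norm_of_nonneg (by positivity)]
      have hk : (0 : ℝ) ≤ k := Nat.cast_nonneg k
      refine sq_le_sq.2 ?_
      rcases max_cases (-(k : ℝ)) (min k (Y 0 ω)) with h1 | h1 <;>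
      rcases min_cases (k : ℝ) (Y 0 ω) with h2 | h2 <;>
      rcases abs_cases (Y 0 ω) with h3 | h3 <;>
      exact abs_le.2 ⟨by linarith, by linarith⟩
    · obtain ⟨k₀, hk₀⟩ := exists_nat_ge |Y 0 ω|
      refine tendsto_const_nhds.congr' ?_
      filter_upwards [eventually_ge_atTop k₀] with k hk
      have : |Y 0 ω| ≤ k := hk₀.trans (by exact_mod_cast hk)
      rw [min_eq_right (abs_le.1 this).2, max_eq_right (abs_le.1 this).1]
      simp
  rw [integral_zero] at hlim
  obtain ⟨k, hk⟩ := (hlim.eventually_lt_const hε).exists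
  exact ⟨k, hk⟩

variable [IsProbabilityMeasure P]

theorem memLp_centredSum (h : IIDSquareIntegrable P Y) (N : ℕ) :
    MemLp (centredSum P Y N) 2 P := by
  unfold centredSum
  exact memLp_finsetSum _ fun i _ => (h.memLp_all i).sub (memLp_const _)

theorem integral_centredSum_sq (h : IIDSquareIntegrable P Y) (N : ℕ) :
    ∫ ω, (centredSum P Y N ω) ^ 2 ∂P = N * variance (Y 0) P := by
  have hv := IndepFun.variance_sum (μ := P) (X := Y) (s := Finset.range N)
    (fun i _ => h.memLp_all i) (fun i _ j _ hij => h.indep.indepFun hij)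
  have hvar : ∀ i, variance (Y i) P = variance (Y 0) P := fun i => (h.ident i).variance_eq
  have hint : ∀ i, ∫ ω, Y i ω ∂P = ∫ ω, Y 0 ω ∂P := fun i => (h.ident i).integral_eq
  rw [variance_eq_integral] at hv
  · simp only [hvar, Finset.sum_const, Finset.card_range, nsmul_eq_mul] at hv
    rw [← hv]
    refine integral_congr_ae (ae_of_all _ fun ω => ?_)
    simp only [centredSum, Finset.sum_apply]
    rw [integral_finsetSum _ fun i _ => (h.memLp_all i).integrable (by norm_num)]
    simp [hint, Finset.sum_sub_distrib]
  · exact (memLp_finsetSum' _ fun i _ => h.memLp_all i).aestronglyMeasurable.aemeasurable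

/-- For bounded variables the fourth moment of the centred sum is of order `N ^ 2`. -/
theorem exists_pow_four_bound (h : IIDSquareIntegrable P Y) {k : ℝ}
    (hk : ∀ᵐ ω ∂P, Y 0 ω ∈ Icc (-k) k) :
    ∃ C : ℝ, 0 ≤ C ∧ ∀ N : ℕ, 0 < N →
      Integrable (fun ω => (centredSum P Y N ω) ^ 4) P ∧
      ∫ ω, (centredSum P Y N ω) ^ 4 ∂P ≤ C * (N : ℝ) ^ 2 := by
  -- The sub-Gaussian parameter in Hoeffding's lemma for an interval `[-k, k]`; independence makes
  -- it additive over the sum.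
  set c : NNReal := (‖k - -k‖₊ / 2) ^ 2 with hc
  have hint : ∀ i, ∫ ω, Y i ω ∂P = ∫ ω, Y 0 ω ∂P := fun i => (h.ident i).integral_eq
  have hsub : ∀ i, HasSubgaussianMGF (fun ω => Y i ω - ∫ ω', Y 0 ω' ∂P) c P := fun i => by
    have := hasSubgaussianMGF_of_mem_Icc (μ := P) (X := Y i) (a := -k) (b := k)
      (h.ident i).aemeasurable_fst
      ((h.ident i).symm.ae_mem_snd measurableSet_Icc hk)
    rwa [hint i] at this
  have hsum : ∀ N : ℕ, HasSubgaussianMGF (centredSum P Y N) (N * c) P := fun N => by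
    have hind : iIndepFun (fun i ω => Y i ω - ∫ ω', Y 0 ω' ∂P) P :=
      h.indep.comp (fun _ y => y - ∫ ω', Y 0 ω' ∂P) fun _ => by fun_prop
    have := HasSubgaussianMGF.sum_of_iIndepFun hind (s := Finset.range N) (c := fun _ => c)
      fun i _ => hsub i
    rw [Finset.sum_const, Finset.card_range, nsmul_eq_mul] at this
    exact this
  refine ⟨48 * Real.exp (c / 2), by positivity, fun N hN => ?_⟩
  have hN' : (0 : ℝ) < N := by exact_mod_cast hN
  have hs : 0 < Real.sqrt N := Real.sqrt_pos.2 hN'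
  have hss : Real.sqrt N ^ 2 = N := Real.sq_sqrt hN'.le
  -- At the scale `1 / √N` the bound `exp (N c t² / 2)` on the moment generating function does not
  -- depend on `N`.
  set t : ℝ := (Real.sqrt N)⁻¹ with ht
  have ht2 : (N : ℝ) * t ^ 2 = 1 := by rw [ht, inv_pow, hss]; field_simp
  have hbd : ∀ u : ℝ, u ^ 2 = t ^ 2 →
      ∫ ω, Real.exp (u * centredSum P Y N ω) ∂P ≤ Real.exp (c / 2) := fun u hu => by
    refine ((hsum N).mgf_le u).trans (Real.exp_le_exp.2 ?_)
    rw [hu]; push_cast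
    rw [mul_comm (N : ℝ), mul_assoc, ht2]; simp
  have hi1 := (hsum N).integrable_exp_mul t
  have hi2 := (hsum N).integrable_exp_mul (-t)
  have hpt : ∀ ω, (centredSum P Y N ω) ^ 4 ≤ 24 * (N : ℝ) ^ 2 *
      (Real.exp (t * centredSum P Y N ω) + Real.exp (-t * centredSum P Y N ω)) := fun ω => by
    have h1 := pow_four_le_exp (t * centredSum P Y N ω)
    have h2 : (centredSum P Y N ω) ^ 4 = (N : ℝ) ^ 2 * (t * centredSum P Y N ω) ^ 4 := by
      calc (centredSum P Y N ω) ^ 4 = ((N : ℝ) * t ^ 2) ^ 2 * (centredSum P Y N ω) ^ 4 := by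
            rw [ht2]; ring
        _ = _ := by ring
    rw [h2, neg_mul]
    nlinarith [sq_nonneg (N : ℝ)]
  have hbint : Integrable (fun ω => 24 * (N : ℝ) ^ 2 *
      (Real.exp (t * centredSum P Y N ω) + Real.exp (-t * centredSum P Y N ω))) P :=
    (hi1.add hi2).const_mul _
  have hi4 : Integrable (fun ω => (centredSum P Y N ω) ^ 4) P := by
    refine hbint.mono' ((h.memLp_centredSum N).aestronglyMeasurable.pow 4) (ae_of_all _ fun ω => ?_)
    rw [Real.norm_of_nonneg (by positivity)]
    exact hpt ω
  refine ⟨hi4, (integral_mono hi4 hbint hpt).trans ?_⟩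
  rw [integral_const_mul, integral_add hi1 hi2]
  have h1 := hbd t rfl
  have h2 := hbd (-t) (by ring)
  nlinarith [sq_nonneg (N : ℝ)]

/-- Uniform integrability of the squares of the normalized centred sums. -/
theorem tendsto_setIntegral_centredSum_sq (h : IIDSquareIntegrable P Y) {A : ℕ → Set Ω}
    (hA : Tendsto (fun N => P.real (A N)) atTop (𝓝 0)) :
    Tendsto (fun N : ℕ => (∫ ω in A N, (centredSum P Y N ω) ^ 2 ∂P) / N) atTop (𝓝 0) := by
  refine tendsto_order.2 ⟨fun a ha => Eventually.of_forall fun N =>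
    ha.trans_le (div_nonneg (integral_nonneg fun ω => sq_nonneg _) (Nat.cast_nonneg N)),
    fun ε hε => ?_⟩
  -- The truncated part has a fourth-moment bound and the remainder has small variance. The three
  -- contributions are each at most `ε / 8 * N` and enter with a factor `2`.
  obtain ⟨k, hk⟩ := h.exists_truncation (ε := ε / 8) (by positivity)
  set τ : ℝ → ℝ := fun y => max (-(k : ℝ)) (min k y) with hτ
  have hτm : Measurable τ := by fun_prop
  have hτb : ∀ y, τ y ∈ Icc (-(k : ℝ)) k := fun y =>
    ⟨le_max_left _ _, max_le (by linarith [(Nat.cast_nonneg k : (0 : ℝ) ≤ k)]) (min_le_left _ _)⟩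
  have hT2 : MemLp (fun ω => τ (Y 0 ω)) 2 P := by
    refine MemLp.of_bound (hτm.comp_aemeasurable h.memLp.aestronglyMeasurable.aemeasurable
      ).aestronglyMeasurable k (ae_of_all _ fun ω => ?_)
    exact abs_le.2 (hτb _)
  have hT : IIDSquareIntegrable P (fun n ω => τ (Y n ω)) := h.comp hτm hT2
  have hU : IIDSquareIntegrable P (fun n ω => Y n ω - τ (Y n ω)) :=
    h.comp (g := fun y => y - τ y) (by fun_prop) (h.memLp.sub hT2)
  obtain ⟨C, hC, hC4⟩ := hT.exists_pow_four_bound (k := k) (ae_of_all _ fun ω => hτb _)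
  have hvar : variance (fun ω => Y 0 ω - τ (Y 0 ω)) P < ε / 8 :=
    (variance_le_expectation_sq hU.memLp.aestronglyMeasurable).trans_lt hk
  -- `R * N` is the level in `S₁² ≤ R N + S₁⁴ / (R N)`: the last term contributes at most `C / R *
  -- N`, and the first is small once `P.real (A N)` is. The `+ 1` keeps `R` positive when `C = 0`.
  set R : ℝ := 8 * (C + 1) / ε with hR
  have hRpos : 0 < R := by positivity
  have hCR : C / R ≤ ε / 8 := by
    rw [hR, div_div_eq_mul_div, div_le_div_iff₀ (by positivity) (by positivity)]
    nlinarith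
  filter_upwards [hA.eventually_lt_const (show (0 : ℝ) < ε / (8 * R) by positivity),
    eventually_gt_atTop 0] with N hPA hN
  have hN' : (0 : ℝ) < N := by exact_mod_cast hN
  rw [div_lt_iff₀ hN']
  have hdec : ∀ ω, centredSum P Y N ω = centredSum P (fun n ω => τ (Y n ω)) N ω +
      centredSum P (fun n ω => Y n ω - τ (Y n ω)) N ω := fun ω => by
    simp only [centredSum, ← Finset.sum_add_distrib]
    rw [integral_sub (h.memLp.integrable (by norm_num)) (hT2.integrable (by norm_num))]
    exact Finset.sum_congr rfl fun i _ => by ring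
  set S₁ := centredSum P (fun n ω => τ (Y n ω)) N with hS₁
  set S₂ := centredSum P (fun n ω => Y n ω - τ (Y n ω)) N with hS₂
  obtain ⟨hi4, hb4⟩ := hC4 N hN
  have hi2 : Integrable (fun ω => S₂ ω ^ 2) P := (hU.memLp_centredSum N).integrable_sq
  have hpt : ∀ ω, (centredSum P Y N ω) ^ 2 ≤
      2 * (R * N + S₁ ω ^ 4 / (R * N)) + 2 * S₂ ω ^ 2 := fun ω => by
    rw [hdec ω]
    have h1 : S₁ ω ^ 2 ≤ R * N + S₁ ω ^ 4 / (R * N) := by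
      rw [← sub_nonneg]
      have : R * N + S₁ ω ^ 4 / (R * N) - S₁ ω ^ 2 =
          ((R * N - S₁ ω ^ 2 / 2) ^ 2 + 3 / 4 * S₁ ω ^ 4) / (R * N) := by
        field_simp; ring
      rw [this]; positivity
    nlinarith [sq_nonneg (S₁ ω - S₂ ω)]
  have hib : Integrable (fun ω => 2 * (R * N + S₁ ω ^ 4 / (R * N)) + 2 * S₂ ω ^ 2) P :=
    (((integrable_const _).add (hi4.div_const _)).const_mul 2).add (hi2.const_mul 2)
  have hA1 : ∫ ω in A N, S₁ ω ^ 4 ∂P ≤ C * (N : ℝ) ^ 2 :=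
    (setIntegral_le_integral hi4 (ae_of_all _ fun ω => by positivity)).trans hb4
  have hA2 : ∫ ω in A N, S₂ ω ^ 2 ∂P ≤ N * (ε / 8) := by
    refine (setIntegral_le_integral hi2 (ae_of_all _ fun ω => sq_nonneg _)).trans ?_
    rw [hU.integral_centredSum_sq]
    gcongr
  calc ∫ ω in A N, (centredSum P Y N ω) ^ 2 ∂P
      ≤ ∫ ω in A N, (2 * (R * N + S₁ ω ^ 4 / (R * N)) + 2 * S₂ ω ^ 2) ∂P :=
        integral_mono (h.memLp_centredSum N).integrable_sq.integrableOn hib.integrableOn hpt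
    _ = 2 * (P.real (A N) * (R * N) + (∫ ω in A N, S₁ ω ^ 4 ∂P) / (R * N)) +
          2 * ∫ ω in A N, S₂ ω ^ 2 ∂P := by
        have i1 : Integrable (fun ω => S₁ ω ^ 4 / (R * N)) (P.restrict (A N)) :=
          (hi4.div_const _).integrableOn
        have i2 : Integrable (fun ω => 2 * S₂ ω ^ 2) (P.restrict (A N)) :=
          (hi2.const_mul 2).integrableOn
        have i3 : Integrable (fun ω => 2 * (R * N + S₁ ω ^ 4 / (R * N))) (P.restrict (A N)) :=
          ((integrable_const _).add i1).const_mul 2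
        rw [integral_add i3 i2, integral_const_mul, integral_const_mul,
          integral_add (integrable_const _) i1, integral_div, setIntegral_const, smul_eq_mul]
    _ < ε * N := by
        have e1 : P.real (A N) * (R * N) ≤ ε / 8 * N := by
          have : P.real (A N) * R ≤ ε / 8 := by
            rw [lt_div_iff₀ (by positivity)] at hPA; linarith
          nlinarith
        have e2 : (∫ ω in A N, S₁ ω ^ 4 ∂P) / (R * N) ≤ ε / 8 * N := by
          calc (∫ ω in A N, S₁ ω ^ 4 ∂P) / (R * N) ≤ C * (N : ℝ) ^ 2 / (R * N) := by gcongr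
            _ = C / R * N := by field_simp
            _ ≤ ε / 8 * N := by gcongr
        nlinarith [mul_pos hε hN']

end IIDSquareIntegrable

/-! ### Rare events -/

/-- A sequence of events whose probabilities are `o(1 / N)` and of which almost surely only
finitely many occur. -/
def Rare {Ω : Type*} [MeasurableSpace Ω] (P : Measure Ω) (B : ℕ → Set Ω) : Prop :=
  Tendsto (fun N : ℕ => (N : ℝ) * P.real (B N)) atTop (𝓝 0) ∧
    ∀ᵐ ω ∂P, ∀ᶠ N in atTop, ω ∉ B N

namespace Rare

variable {Ω : Type*} [MeasurableSpace Ω] {P : Measure Ω} {B C : ℕ → Set Ω}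

theorem mono [IsFiniteMeasure P] (hC : Rare P C) (h : ∀ N, B N ⊆ C N) : Rare P B := by
  refine ⟨squeeze_zero (fun N => by positivity) (fun N => ?_) hC.1, ?_⟩
  · exact mul_le_mul_of_nonneg_left (measureReal_mono (h N)) (Nat.cast_nonneg N)
  · filter_upwards [hC.2] with ω hω
    filter_upwards [hω] with N hN using fun hB => hN (h N hB)

theorem union (hB : Rare P B) (hC : Rare P C) : Rare P (fun N => B N ∪ C N) := by
  refine ⟨?_, ?_⟩
  · have := hB.1.add hC.1
    rw [add_zero] at this
    refine squeeze_zero (fun N => by positivity) (fun N => ?_) this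
    rw [← mul_add]
    exact mul_le_mul_of_nonneg_left (measureReal_union_le _ _) (Nat.cast_nonneg N)
  · filter_upwards [hB.2, hC.2] with ω h1 h2
    filter_upwards [h1, h2] with N hN1 hN2
    simp [hN1, hN2]

theorem of_ae {s : Set Ω} (hs : ∀ᵐ ω ∂P, ω ∉ s) : Rare P (fun _ => s) := by
  refine ⟨?_, ?_⟩
  · have : P.real s = 0 := by
      have h0 : P s = 0 := by simpa [ae_iff] using hs
      simp [Measure.real, h0]
    simp [this]
  · filter_upwards [hs] with ω h using Eventually.of_forall fun _ => h

theorem tendsto_measureReal (hB : Rare P B) :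
    Tendsto (fun N => P.real (B N)) atTop (𝓝 0) := by
  refine squeeze_zero' (Eventually.of_forall fun N => measureReal_nonneg) ?_ hB.1
  filter_upwards [eventually_ge_atTop 1] with N hN
  have : (1 : ℝ) ≤ N := by exact_mod_cast hN
  nlinarith [measureReal_nonneg (μ := P) (s := B N)]

end Rare

/-- For square-integrable variables, deviations of the empirical mean are rare. -/
theorem IIDSquareIntegrable.rare_deviation {Ω : Type*} [MeasurableSpace Ω] {P : Measure Ω}
    [IsProbabilityMeasure P] {Y : ℕ → Ω → ℝ} (h : IIDSquareIntegrable P Y) {ε : ℝ} (hε : 0 < ε) :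
    Rare P (fun N => {ω | ε ≤ |(∑ i ∈ Finset.range N, Y i ω) / N - ∫ ω', Y 0 ω' ∂P|}) := by
  set m := ∫ ω', Y 0 ω' ∂P with hm
  set A : ℕ → Set Ω := fun N => {ω | ε ≤ |(∑ i ∈ Finset.range N, Y i ω) / N - m|} with hA
  have hsum : ∀ N ω, centredSum P Y N ω = ∑ i ∈ Finset.range N, Y i ω - N * m := fun N ω => by
    simp [centredSum, Finset.sum_sub_distrib, hm]
  have hmem : ∀ N : ℕ, 0 < N → ∀ ω ∈ A N, (N : ℝ) ^ 2 * ε ^ 2 ≤ (centredSum P Y N ω) ^ 2 := by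
    intro N hN ω hω
    have hN' : (0 : ℝ) < N := by exact_mod_cast hN
    have h1 : centredSum P Y N ω = N * ((∑ i ∈ Finset.range N, Y i ω) / N - m) := by
      rw [hsum]; field_simp
    rw [h1, mul_pow]
    have h2 : ε ^ 2 ≤ ((∑ i ∈ Finset.range N, Y i ω) / N - m) ^ 2 := by
      rw [← sq_abs (_ - m)]
      exact pow_le_pow_left₀ hε.le hω 2
    gcongr
  have hbound : ∀ N : ℕ, 0 < N →
      (N : ℝ) * P.real (A N) ≤ (∫ ω in A N, (centredSum P Y N ω) ^ 2 ∂P) / N / ε ^ 2 := by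
    intro N hN
    have hN' : (0 : ℝ) < N := by exact_mod_cast hN
    -- Markov's inequality is applied under the restriction to `A N`, so that the bound keeps the
    -- integral over `A N` only.
    have hmk := mul_meas_ge_le_integral_of_nonneg (μ := P.restrict (A N))
      (f := fun ω => (centredSum P Y N ω) ^ 2) (ae_of_all _ fun ω => sq_nonneg _)
      (h.memLp_centredSum N).integrable_sq.integrableOn ((N : ℝ) ^ 2 * ε ^ 2)
    have hle : P.real (A N) ≤
        (P.restrict (A N)).real {ω | (N : ℝ) ^ 2 * ε ^ 2 ≤ (centredSum P Y N ω) ^ 2} := by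
      calc P.real (A N) = (P.restrict (A N)).real (A N) := by
            simp [Measure.real, Measure.restrict_apply_self]
        _ ≤ _ := measureReal_mono (hmem N hN)
    rw [div_div, le_div_iff₀ (by positivity)]
    calc (N : ℝ) * P.real (A N) * (N * ε ^ 2) = (N : ℝ) ^ 2 * ε ^ 2 * P.real (A N) := by ring
      _ ≤ _ := (mul_le_mul_of_nonneg_left hle (by positivity)).trans hmk
  refine ⟨?_, ?_⟩
  -- Bootstrap: Chebyshev gives `P.real (A N) → 0`, and uniform integrability over these same sets
  -- then improves the rate to `o(1 / N)`.
  · have h0 : Tendsto (fun N => P.real (A N)) atTop (𝓝 0) := by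
      have hlim : Tendsto (fun N : ℕ => variance (Y 0) P / ε ^ 2 * (N : ℝ)⁻¹) atTop (𝓝 0) := by
        simpa using tendsto_inv_atTop_nhds_zero_nat.const_mul (variance (Y 0) P / ε ^ 2)
      refine squeeze_zero' (Eventually.of_forall fun N => measureReal_nonneg) ?_ hlim
      filter_upwards [eventually_gt_atTop 0] with N hN
      have hN' : (0 : ℝ) < N := by exact_mod_cast hN
      have h1 := hbound N hN
      have h2 : ∫ ω in A N, (centredSum P Y N ω) ^ 2 ∂P ≤ N * variance (Y 0) P := by
        rw [← h.integral_centredSum_sq]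
        exact setIntegral_le_integral (h.memLp_centredSum N).integrable_sq
          (ae_of_all _ fun ω => sq_nonneg _)
      have h3 : (∫ ω in A N, (centredSum P Y N ω) ^ 2 ∂P) / N / ε ^ 2 ≤
          variance (Y 0) P / ε ^ 2 := by
        gcongr
        rw [div_le_iff₀ hN']; linarith
      rw [← div_eq_mul_inv, le_div_iff₀ hN']
      linarith
    have h1 := (h.tendsto_setIntegral_centredSum_sq h0).div_const (ε ^ 2)
    rw [zero_div] at h1
    refine squeeze_zero' (Eventually.of_forall fun N => by positivity) ?_ h1
    filter_upwards [eventually_gt_atTop 0] with N hN using hbound N hN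
  · have hslln := strong_law_ae_real Y (h.memLp.integrable (by norm_num))
      (fun i j hij => h.indep.indepFun hij) h.ident
    filter_upwards [hslln] with ω hω
    filter_upwards [Metric.tendsto_atTop'.1 hω ε hε |>.choose_spec |> fun h =>
      (eventually_gt_atTop _).mono fun N hN => h N hN] with N hN
    rw [Real.dist_eq] at hN
    simpa [hA] using hN

/-- If, outside rare events, `W N` lies between multiples arbitrarily close to `1 / J ^ 2` of the
squared centred empirical mean, then `N * 𝔼[W N]` tends to `Var[Y 0] / J ^ 2`. -/
theorem IIDSquareIntegrable.tendsto_mul_integral_of_sandwich {Ω : Type*} [MeasurableSpace Ω]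
    {P : Measure Ω} [IsProbabilityMeasure P] {Y : ℕ → Ω → ℝ} (h : IIDSquareIntegrable P Y)
    {J D : ℝ} (hJ : 0 < J) {W : ℕ → Ω → ℝ} (hWm : ∀ N, AEStronglyMeasurable (W N) P)
    (hW : ∀ N, ∀ᵐ ω ∂P, 0 ≤ W N ω ∧ W N ω ≤ D)
    (hsand : ∀ η, 0 < η → η < J → ∃ B, Rare P B ∧ ∀ N : ℕ, ∀ᵐ ω ∂P, ω ∉ B N →
      (centredSum P Y N ω / N) ^ 2 / (J + η) ^ 2 ≤ W N ω ∧
      W N ω ≤ (centredSum P Y N ω / N) ^ 2 / (J - η) ^ 2) :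
    Tendsto (fun N : ℕ => (N : ℝ) * ∫ ω, W N ω ∂P) atTop (𝓝 (variance (Y 0) P / J ^ 2)) := by
  set V := variance (Y 0) P with hV
  have hWi : ∀ N, Integrable (W N) P := fun N => by
    refine Integrable.of_bound (hWm N) D ?_
    filter_upwards [hW N] with ω hω
    rw [Real.norm_of_nonneg hω.1]; exact hω.2
  have hS2 : ∀ N, Integrable (fun ω => (centredSum P Y N ω) ^ 2) P := fun N =>
    (h.memLp_centredSum N).integrable_sq
  -- The lower bound loses the squared sum on the exceptional event, where only `0 ≤ W N` is known;
  -- the upper bound loses at most `D` times its probability. Both losses vanish after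
  -- multiplication by `N`.
  have hbounds : ∀ η, 0 < η → η < J → ∃ e₁ e₂ : ℕ → ℝ, Tendsto e₁ atTop (𝓝 0) ∧
      Tendsto e₂ atTop (𝓝 0) ∧ ∀ N : ℕ, 0 < N →
        V / (J + η) ^ 2 - e₁ N ≤ N * ∫ ω, W N ω ∂P ∧
        N * ∫ ω, W N ω ∂P ≤ V / (J - η) ^ 2 + e₂ N := by
    intro η hη hηJ
    obtain ⟨B, hB, hBW⟩ := hsand η hη hηJ
    -- The exceptional events need not be measurable; their hulls have the same probability.
    set A : ℕ → Set Ω := fun N => toMeasurable P (B N) with hA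
    have hAm : ∀ N, MeasurableSet (A N) := fun N => measurableSet_toMeasurable _ _
    have hAP : ∀ N, P.real (A N) = P.real (B N) := fun N => by
      simp [hA, Measure.real, measure_toMeasurable]
    have hBA : ∀ N ω, ω ∉ A N → ω ∉ B N := fun N ω hω hB => hω (subset_toMeasurable P _ hB)
    refine ⟨fun N => (∫ ω in A N, (centredSum P Y N ω) ^ 2 ∂P) / N / (J + η) ^ 2,
      fun N => D * (N * P.real (B N)), ?_, ?_, fun N hN => ?_⟩
    · have := (h.tendsto_setIntegral_centredSum_sq (A := A)
        (by simpa only [hAP] using hB.tendsto_measureReal)).div_const ((J + η) ^ 2)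
      rwa [zero_div] at this
    · simpa using hB.1.const_mul D
    have hN' : (0 : ℝ) < N := by exact_mod_cast hN
    have hJη : 0 < J - η := by linarith
    have hscale : ∀ k : ℝ, 0 < k →
        ∫ ω, (centredSum P Y N ω) ^ 2 * ((N : ℝ) ^ 2 * k ^ 2)⁻¹ ∂P = V / k ^ 2 / N := by
      intro k hk
      rw [integral_mul_const, h.integral_centredSum_sq, ← hV]
      field_simp
    have hdiv : ∀ k ω, (centredSum P Y N ω / N) ^ 2 / k ^ 2 =
        (centredSum P Y N ω) ^ 2 * ((N : ℝ) ^ 2 * k ^ 2)⁻¹ := fun k ω => by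
      rw [div_pow, div_div, div_eq_mul_inv]
    have hmono_low : ∫ ω, ((centredSum P Y N ω) ^ 2 * ((N : ℝ) ^ 2 * (J + η) ^ 2)⁻¹ -
        (A N).indicator (fun ω => (centredSum P Y N ω) ^ 2 * ((N : ℝ) ^ 2 * (J + η) ^ 2)⁻¹) ω) ∂P
        ≤ ∫ ω, W N ω ∂P := by
      refine integral_mono_ae (((hS2 N).mul_const _).sub
        (((hS2 N).mul_const _).indicator (hAm N))) (hWi N) ?_
      filter_upwards [hBW N, hW N] with ω h1 h2
      by_cases hω : ω ∈ A N
      · simpa [hω] using h2.1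
      · simpa [hω, hdiv] using (h1 (hBA N ω hω)).1
    have hmono_up : ∫ ω, W N ω ∂P ≤
        ∫ ω, ((centredSum P Y N ω) ^ 2 * ((N : ℝ) ^ 2 * (J - η) ^ 2)⁻¹ +
          (A N).indicator (fun _ => D) ω) ∂P := by
      refine integral_mono_ae (hWi N) (((hS2 N).mul_const _).add
        ((integrable_const _).indicator (hAm N))) ?_
      filter_upwards [hBW N, hW N] with ω h1 h2
      by_cases hω : ω ∈ A N
      · simp only [hω, indicator_of_mem]
        have : 0 ≤ (centredSum P Y N ω) ^ 2 * ((N : ℝ) ^ 2 * (J - η) ^ 2)⁻¹ := by positivity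
        linarith
      · simpa [hω, hdiv] using (h1 (hBA N ω hω)).2
    rw [integral_sub ((hS2 N).mul_const _) (((hS2 N).mul_const _).indicator (hAm N)),
      hscale _ (by linarith), integral_indicator (hAm N), integral_mul_const] at hmono_low
    rw [integral_add ((hS2 N).mul_const _) ((integrable_const _).indicator (hAm N)),
      hscale _ hJη, integral_indicator (hAm N), setIntegral_const, hAP, smul_eq_mul] at hmono_up
    constructor
    · calc V / (J + η) ^ 2 - (∫ ω in A N, (centredSum P Y N ω) ^ 2 ∂P) / N / (J + η) ^ 2
          = N * (V / (J + η) ^ 2 / N -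
            (∫ ω in A N, (centredSum P Y N ω) ^ 2 ∂P) * ((N : ℝ) ^ 2 * (J + η) ^ 2)⁻¹) := by
            field_simp
        _ ≤ _ := mul_le_mul_of_nonneg_left hmono_low hN'.le
    · calc (N : ℝ) * ∫ ω, W N ω ∂P ≤ N * (V / (J - η) ^ 2 / N + P.real (B N) * D) :=
            mul_le_mul_of_nonneg_left hmono_up hN'.le
        _ = _ := by field_simp
  have hlimη : ∀ σ : ℝ, Tendsto (fun η : ℝ => V / (J + σ * η) ^ 2) (𝓝[>] 0) (𝓝 (V / J ^ 2)) := by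
    intro σ
    have hc : ContinuousAt (fun η : ℝ => V / (J + σ * η) ^ 2) 0 := by
      refine ContinuousAt.div (by fun_prop) (by fun_prop) ?_
      simp [hJ.ne']
    have := hc.tendsto
    simp only [mul_zero, add_zero] at this
    exact this.mono_left nhdsWithin_le_nhds
  have hsmall : ∀ᶠ η : ℝ in 𝓝[>] 0, 0 < η ∧ η < J := Ioo_mem_nhdsGT hJ
  -- For each strict bound `x`, a small `η` is fixed first, and only then does `N` grow.
  refine tendsto_order.2 ⟨fun x hx => ?_, fun x hx => ?_⟩
  · obtain ⟨η, hη1, hη2⟩ := (((hlimη 1).eventually_const_lt hx).and hsmall).exists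
    obtain ⟨e₁, e₂, he₁, -, hb⟩ := hbounds η hη2.1 hη2.2
    rw [one_mul] at hη1
    filter_upwards [he₁.eventually_lt_const (sub_pos.2 hη1), eventually_gt_atTop 0] with N h1 hN
    linarith [(hb N hN).1]
  · obtain ⟨η, hη1, hη2⟩ := (((hlimη (-1)).eventually_lt_const hx).and hsmall).exists
    obtain ⟨e₁, e₂, -, he₂, hb⟩ := hbounds η hη2.1 hη2.2
    rw [neg_one_mul, ← sub_eq_add_neg] at hη1
    filter_upwards [he₂.eventually_lt_const (sub_pos.2 hη1), eventually_gt_atTop 0] with N h1 hN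
    linarith [(hb N hN).2]

/-! ### Functions close to a concave parabola -/

/-- The quadratic `x * (k * x - s)` is nonpositive exactly between its roots; an unordered interval
avoids fixing the sign of `s`. -/
theorem mem_uIcc_zero_div_iff {k s x : ℝ} (hk : 0 < k) :
    x ∈ uIcc 0 (s / k) ↔ k * x ^ 2 ≤ s * x := by
  have hs : s = k * (s / k) := by field_simp
  set r := s / k
  rw [hs, mul_assoc, mul_le_mul_iff_right₀ hk, mem_uIcc]
  constructor
  · rintro (⟨h1, h2⟩ | ⟨h1, h2⟩) <;> nlinarith
  · intro h
    rcases lt_trichotomy x 0 with hx | hx | hx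
    · right; exact ⟨by nlinarith, hx.le⟩
    · subst hx; rcases le_total 0 r with h0 | h0 <;> simp [h0]
    · left; exact ⟨hx.le, by nlinarith⟩

theorem setIntegral_uIcc_zero_abs (r : ℝ) : ∫ x in uIcc 0 r, |x| = r ^ 2 / 2 := by
  rcases le_total 0 r with h | h
  · rw [uIcc_of_le h, setIntegral_congr_fun (g := fun x => x) measurableSet_Icc
      (fun x hx => abs_of_nonneg hx.1), integral_Icc_eq_integral_Ioc,
      ← intervalIntegral.integral_of_le h, integral_id]
    ring
  · rw [uIcc_of_ge h, setIntegral_congr_fun (g := fun x => -x) measurableSet_Icc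
      (fun x hx => abs_of_nonpos hx.2), integral_Icc_eq_integral_Ioc,
      ← intervalIntegral.integral_of_le h, intervalIntegral.integral_neg, integral_id]
    ring

/-- Negativity of the parabola at both `δ` and `-δ` confines its nonzero root `2 * s / k` to the
window. -/
theorem abs_lt_of_parabola {δ k s : ℝ} (hδ : 0 < δ) (h₁ : s * δ < k * δ ^ 2 / 2)
    (h₂ : -(s * δ) < k * δ ^ 2 / 2) : 2 * |s| < k * δ := by
  have : |s| * δ < k * δ ^ 2 / 2 := by
    rcases abs_cases s with h | h <;> rw [h.1] <;> linarith
  nlinarith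

/-- The superlevel set at height `0` of a function close to the parabola `s * t - J * t ^ 2 / 2`
is close to the interval between `0` and `2 * s / J`. -/
theorem superlevel_integral_sandwich {a c δ J η s : ℝ} {L : ℝ → ℝ} (hL : Measurable L)
    (hδ : 0 < δ) (ha : a < -δ) (hc : δ < c) (hη : 0 < η) (hηJ : η < J)
    (hfar : ∀ t ∈ Icc a c, δ ≤ |t| → L t < 0)
    (hnear : ∀ t, |t| ≤ δ → |L t - (s * t - J * t ^ 2 / 2)| ≤ η * t ^ 2 / 2) :
    s ^ 2 / (J + η) ^ 2 ≤ 2 * ∫ ε in (a / 2)..(c / 2), {ε | 0 ≤ L (2 * ε)}.indicator (|·|) ε ∧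
    2 * ∫ ε in (a / 2)..(c / 2), {ε | 0 ≤ L (2 * ε)}.indicator (|·|) ε ≤ s ^ 2 / (J - η) ^ 2 := by
  have hE : MeasurableSet {ε | 0 ≤ L (2 * ε)} :=
    measurableSet_le measurable_const (hL.comp (measurable_const_mul 2))
  have hJη : 0 < J - η := by linarith
  have hJη' : 0 < J + η := by linarith
  rw [intervalIntegral.integral_of_le (by linarith), setIntegral_indicator hE]
  have hint : ∀ r : ℝ, IntegrableOn (fun x : ℝ => |x|) (uIcc 0 r) := fun r =>
    continuous_abs.continuousOn.integrableOn_uIcc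
  -- The roots `0` and `2 * s / k` in `t = 2 * ε` become `0` and `s / k` in `ε`; both sides of the
  -- sandwich are integrals of `|·|` over such intervals, so inclusions of sets suffice.
  have hval : ∀ k : ℝ, s ^ 2 / k ^ 2 = 2 * ∫ x in uIcc 0 (s / k), |x| := fun k => by
    rw [setIntegral_uIcc_zero_abs, div_pow]; ring
  rw [hval (J + η), hval (J - η)]
  -- At `t = δ` and `t = -δ` both `hfar` and `hnear` apply; together they place the inner interval
  -- inside the window.
  have hsmall : 2 * |s| < (J + η) * δ := by
    have h1 := hfar δ ⟨by linarith, hc.le⟩ (le_abs_self δ)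
    have h2 := hfar (-δ) ⟨ha.le, by linarith⟩ (by rw [abs_neg]; exact le_abs_self δ)
    have h3 := abs_le.1 (hnear δ (abs_of_pos hδ).le)
    have h4 := abs_le.1 (hnear (-δ) (by rw [abs_neg]; exact (abs_of_pos hδ).le))
    exact abs_lt_of_parabola hδ (by linarith [h3.1]) (by linarith [h4.1])
  constructor
  · refine mul_le_mul_of_nonneg_left (setIntegral_mono_set ?_ (ae_of_all _ fun x => abs_nonneg x)
      (LE.le.eventuallyLE fun ε hε => ?_)) zero_le_two
    · exact (continuous_abs.integrableOn_Ioc).mono_set inter_subset_left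
    · have hq := (mem_uIcc_zero_div_iff hJη').1 hε
      have habs : |2 * ε| < δ := by
        have h1 : |ε| ≤ |s| / (J + η) := by
          have := abs_sub_left_of_mem_uIcc hε
          rwa [sub_zero, sub_zero, abs_div, abs_of_pos hJη'] at this
        rw [le_div_iff₀ hJη'] at h1
        rw [abs_mul, abs_of_pos (zero_lt_two' ℝ)]
        nlinarith
      have hb := abs_lt.1 habs
      refine ⟨⟨by linarith, by linarith⟩, ?_⟩
      have h1 := abs_le.1 (hnear _ habs.le)
      simp only [mem_ofPred_eq]
      nlinarith [h1.1]
  · refine mul_le_mul_of_nonneg_left (setIntegral_mono_set (hint _)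
      (ae_of_all _ fun x => abs_nonneg x)
      (LE.le.eventuallyLE fun ε hε => ?_)) zero_le_two
    obtain ⟨⟨h1, h2⟩, h3⟩ := hε
    simp only [mem_ofPred_eq] at h3
    rw [mem_uIcc_zero_div_iff hJη]
    have habs : |2 * ε| < δ := by
      by_contra! hcon
      exact absurd (hfar (2 * ε) ⟨by linarith, by linarith⟩ hcon) (by linarith)
    have h4 := abs_le.1 (hnear _ habs.le)
    nlinarith [h4.2]

/-- An error proportional to `|t|` is a relative error, by the triangle inequality in both
directions. The hypothesis is what the vanishing mean score gives for the error `t` of the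
maximizer. -/
theorem sq_sandwich_of_abs_sub_le {J η s t : ℝ} (hη : 0 < η) (hηJ : η < J)
    (h : |s - J * t| ≤ η * |t|) : s ^ 2 / (J + η) ^ 2 ≤ t ^ 2 ∧ t ^ 2 ≤ s ^ 2 / (J - η) ^ 2 := by
  have hJ : 0 < J := hη.trans hηJ
  have hJt : |J * t| = J * |t| := by rw [abs_mul, abs_of_pos hJ]
  have h1 : |s| ≤ (J + η) * |t| := by
    have := abs_sub_abs_le_abs_sub s (J * t)
    linarith
  have h2 : (J - η) * |t| ≤ |s| := by
    have := abs_sub_abs_le_abs_sub (J * t) s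
    rw [abs_sub_comm] at this
    linarith
  have hp : 0 < J + η := by linarith
  have hm : 0 < J - η := by linarith
  constructor
  · rw [div_le_iff₀ (by positivity), ← sq_abs s, ← sq_abs t, ← mul_pow, mul_comm]
    exact pow_le_pow_left₀ (abs_nonneg _) h1 2
  · rw [le_div_iff₀ (by positivity), ← sq_abs s, ← sq_abs t, ← mul_pow, mul_comm]
    exact pow_le_pow_left₀ (by positivity) h2 2

/-! ### Taylor estimates with a bound on the third derivative -/

section Taylor

variable {u v θ₀ θ θ' : ℝ} {φ : ℝ → ℝ}

theorem hasDerivWithinAt_iteratedDerivWithin (huv : u < v) (hφ : ContDiffOn ℝ 3 φ (Icc u v))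
    {i : ℕ} (hi : i < 3) (hθ : θ ∈ Icc u v) :
    HasDerivWithinAt (iteratedDerivWithin i φ (Icc u v))
      (iteratedDerivWithin (i + 1) φ (Icc u v) θ) (Icc u v) θ := by
  rw [iteratedDerivWithin_succ]
  exact (hφ.differentiableOn_iteratedDerivWithin (by exact_mod_cast hi) (uniqueDiffOn_Icc huv) θ
    hθ).hasDerivWithinAt

theorem abs_iteratedDerivWithin_sub_le (huv : u < v) (hφ : ContDiffOn ℝ 3 φ (Icc u v))
    {i : ℕ} (hi : i < 3) {B : ℝ}
    (hB : ∀ θ ∈ Icc u v, |iteratedDerivWithin (i + 1) φ (Icc u v) θ| ≤ B)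
    (hθ : θ ∈ Icc u v) (hθ' : θ' ∈ Icc u v) :
    |iteratedDerivWithin i φ (Icc u v) θ - iteratedDerivWithin i φ (Icc u v) θ'| ≤
      B * |θ - θ'| :=
  (convex_Icc u v).norm_image_sub_le_of_norm_hasDerivWithin_le
    (fun _ hx => hasDerivWithinAt_iteratedDerivWithin huv hφ hi hx) hB hθ' hθ

/-- Mean value inequality on the segment from `θ₀` to `θ` for the remainder, whose derivative is at
most `B * |θ - θ₀|` there. The constant is not sharp; only the order matters. -/
theorem abs_deriv_sub_linear_le (huv : u < v) (hφ : ContDiffOn ℝ 3 φ (Icc u v)) {B : ℝ}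
    (hB : ∀ θ ∈ Icc u v, |iteratedDerivWithin 3 φ (Icc u v) θ| ≤ B)
    (hθ₀ : θ₀ ∈ Icc u v) (hθ : θ ∈ Icc u v) :
    |iteratedDerivWithin 1 φ (Icc u v) θ - iteratedDerivWithin 1 φ (Icc u v) θ₀ -
      iteratedDerivWithin 2 φ (Icc u v) θ₀ * (θ - θ₀)| ≤ B * (θ - θ₀) ^ 2 := by
  have hB0 : 0 ≤ B := (abs_nonneg _).trans (hB θ₀ hθ₀)
  have hsub : uIcc θ₀ θ ⊆ Icc u v := uIcc_subset_Icc hθ₀ hθ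
  have := (convex_uIcc θ₀ θ).norm_image_sub_le_of_norm_hasDerivWithin_le
    (f := fun y => iteratedDerivWithin 1 φ (Icc u v) y -
      iteratedDerivWithin 2 φ (Icc u v) θ₀ * (y - θ₀))
    (f' := fun y => iteratedDerivWithin 2 φ (Icc u v) y -
      iteratedDerivWithin 2 φ (Icc u v) θ₀) (C := B * |θ - θ₀|)
    (fun y hy => by
      have h1 := (hasDerivWithinAt_iteratedDerivWithin huv hφ (i := 1) (by norm_num)
        (hsub hy)).mono hsub
      have h2 := h1.sub (((hasDerivWithinAt_id y _).sub_const θ₀).const_mul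
        (iteratedDerivWithin 2 φ (Icc u v) θ₀))
      rw [mul_one] at h2
      exact h2)
    (fun y hy => (abs_iteratedDerivWithin_sub_le huv hφ (i := 2) (by norm_num) hB (hsub hy)
      hθ₀).trans (mul_le_mul_of_nonneg_left (abs_sub_left_of_mem_uIcc hy) hB0))
    left_mem_uIcc right_mem_uIcc
  rw [Real.norm_eq_abs, Real.norm_eq_abs, mul_assoc, ← abs_mul, ← sq, abs_sq] at this
  convert this using 2
  ring

/-- The same argument one order higher, with `abs_deriv_sub_linear_le` bounding the derivative of
the remainder. -/
theorem abs_sub_quadratic_le (huv : u < v) (hφ : ContDiffOn ℝ 3 φ (Icc u v)) {B : ℝ}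
    (hB : ∀ θ ∈ Icc u v, |iteratedDerivWithin 3 φ (Icc u v) θ| ≤ B)
    (hθ₀ : θ₀ ∈ Icc u v) (hθ : θ ∈ Icc u v) :
    |φ θ - φ θ₀ - (iteratedDerivWithin 1 φ (Icc u v) θ₀ * (θ - θ₀) +
      iteratedDerivWithin 2 φ (Icc u v) θ₀ * (θ - θ₀) ^ 2 / 2)| ≤ B * |θ - θ₀| ^ 3 := by
  have hB0 : 0 ≤ B := (abs_nonneg _).trans (hB θ₀ hθ₀)
  have hsub : uIcc θ₀ θ ⊆ Icc u v := uIcc_subset_Icc hθ₀ hθ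
  have := (convex_uIcc θ₀ θ).norm_image_sub_le_of_norm_hasDerivWithin_le
    (f := fun y => φ y - (iteratedDerivWithin 1 φ (Icc u v) θ₀ * (y - θ₀) +
      iteratedDerivWithin 2 φ (Icc u v) θ₀ * (y - θ₀) ^ 2 / 2))
    (f' := fun y => iteratedDerivWithin 1 φ (Icc u v) y -
      (iteratedDerivWithin 1 φ (Icc u v) θ₀ +
        iteratedDerivWithin 2 φ (Icc u v) θ₀ * (y - θ₀))) (C := B * |θ - θ₀| ^ 2)
    (fun y hy => by
      have h1 := (hasDerivWithinAt_iteratedDerivWithin huv hφ (i := 0) (by norm_num)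
        (hsub hy)).mono hsub
      rw [iteratedDerivWithin_zero, zero_add] at h1
      have h2 := (hasDerivWithinAt_id y (uIcc θ₀ θ)).sub_const θ₀
      have h3 := (h2.const_mul (iteratedDerivWithin 1 φ (Icc u v) θ₀)).add
        (((h2.pow 2).const_mul (iteratedDerivWithin 2 φ (Icc u v) θ₀)).div_const 2)
      refine (h1.sub h3).congr_deriv ?_
      simp
      ring)
    (fun y hy => by
      have h1 := abs_deriv_sub_linear_le huv hφ hB hθ₀ (hsub hy)
      rw [Real.norm_eq_abs, ← sub_sub]
      refine h1.trans (mul_le_mul_of_nonneg_left ?_ hB0)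
      rw [← sq_abs]
      exact pow_le_pow_left₀ (abs_nonneg _) (abs_sub_left_of_mem_uIcc hy) 2)
    left_mem_uIcc right_mem_uIcc
  rw [Real.norm_eq_abs, Real.norm_eq_abs, mul_assoc, ← pow_succ] at this
  convert this using 2
  ring

end Taylor

/-! ### Empirical means -/

/-- The mean of `g` over the first `N` observations. -/
noncomputable def empMean {S Ω : Type*} (X : ℕ → Ω → S) (g : S → ℝ) (N : ℕ) (ω : Ω) : ℝ :=
  (∑ i ∈ Finset.range N, g (X i ω)) / N

section EmpMean

variable {S Ω : Type*} {X : ℕ → Ω → S} {g h : S → ℝ} {N : ℕ} {ω : Ω}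

theorem empMean_add :
    empMean X (fun x => g x + h x) N ω = empMean X g N ω + empMean X h N ω := by
  simp [empMean, Finset.sum_add_distrib, add_div]

theorem empMean_sub :
    empMean X (fun x => g x - h x) N ω = empMean X g N ω - empMean X h N ω := by
  simp [empMean, Finset.sum_sub_distrib, sub_div]

theorem empMean_mul_const (c : ℝ) :
    empMean X (fun x => g x * c) N ω = empMean X g N ω * c := by
  simp only [empMean, ← Finset.sum_mul]
  ring

theorem abs_empMean_le {c : ℝ} (H : ∀ n, |g (X n ω)| ≤ h (X n ω) * c) :
    |empMean X g N ω| ≤ empMean X h N ω * c := by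
  rw [← empMean_mul_const, empMean, empMean, abs_div, Nat.abs_cast]
  exact div_le_div_of_nonneg_right ((Finset.abs_sum_le_sum_abs _ _).trans
    (Finset.sum_le_sum fun i _ => H i)) (Nat.cast_nonneg N)

end EmpMean

/-- Independent observations with common law `ν`. -/
structure IsIIDSample {S Ω : Type*} [MeasurableSpace S] [MeasurableSpace Ω] (P : Measure Ω)
    (X : ℕ → Ω → S) (ν : Measure S) : Prop where
  measurable : ∀ n, Measurable (X n)
  indep : iIndepFun X P
  law : ∀ n, P.map (X n) = ν

namespace IsIIDSample

variable {S Ω : Type*} [MeasurableSpace S] [MeasurableSpace Ω] {P : Measure Ω}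
  {X : ℕ → Ω → S} {ν : Measure S} {g : S → ℝ}

theorem measurePreserving (hX : IsIIDSample P X ν) (n : ℕ) : MeasurePreserving (X n) P ν :=
  ⟨hX.measurable n, hX.law n⟩

theorem iidSquareIntegrable (hX : IsIIDSample P X ν) (hg : MemLp g 2 ν) :
    IIDSquareIntegrable P (fun n ω => g (X n ω)) := by
  have hgm : ∀ n, AEMeasurable g (P.map (X n)) := fun n => by
    rw [hX.law n]; exact hg.aestronglyMeasurable.aemeasurable
  refine ⟨hX.indep.comp₀ (fun _ => g) (fun n => (hX.measurable n).aemeasurable) hgm, fun n => ?_,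
    hg.comp_measurePreserving (hX.measurePreserving 0)⟩
  have hid : IdentDistrib (X n) (X 0) P P :=
    ⟨(hX.measurable n).aemeasurable, (hX.measurable 0).aemeasurable, by rw [hX.law, hX.law]⟩
  exact hid.comp_of_aemeasurable (hgm n)

theorem integral_comp (hX : IsIIDSample P X ν) (hg : AEStronglyMeasurable g ν) (n : ℕ) :
    ∫ ω, g (X n ω) ∂P = ∫ x, g x ∂ν := by
  rw [← hX.law n] at hg ⊢
  rw [integral_map (hX.measurable n).aemeasurable hg]

theorem ae_forall (hX : IsIIDSample P X ν) {p : S → Prop} (hp : ∀ᵐ x ∂ν, p x) :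
    ∀ᵐ ω ∂P, ∀ n, p (X n ω) :=
  ae_all_iff.2 fun n => (hX.measurePreserving n).quasiMeasurePreserving.ae hp

theorem rare_deviation [IsProbabilityMeasure P] (hX : IsIIDSample P X ν) (hg : MemLp g 2 ν)
    {ε : ℝ} (hε : 0 < ε) :
    Rare P (fun N => {ω | ε ≤ |empMean X g N ω - ∫ x, g x ∂ν|}) := by
  have := (hX.iidSquareIntegrable hg).rare_deviation hε
  rwa [hX.integral_comp hg.aestronglyMeasurable] at this

end IsIIDSample

/-! ### Regular families of densities -/

/-- The smoothness and domination conditions on the log-density at the observation `x`. -/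
structure IsRegularAt {S : Type*} (f : ℝ → S → ℝ) (u v : ℝ) (b : Fin 4 → S → ℝ) (x : S) :
    Prop where
  pos : ∀ θ ∈ Icc u v, 0 < f θ x
  contDiffOn : ContDiffOn ℝ 3 (fun θ => Real.log (f θ x)) (Icc u v)
  bound : ∀ θ ∈ Icc u v, ∀ i : Fin 4, |logDensityDeriv f (Icc u v) i θ x| ≤ b i x

namespace IsRegularAt

variable {S : Type*} {f : ℝ → S → ℝ} {u v θ₀ θ θ' : ℝ} {b : Fin 4 → S → ℝ} {x : S}

theorem nonneg (h : IsRegularAt f u v b x) (hθ : θ ∈ Icc u v) (i : Fin 4) : 0 ≤ b i x :=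
  (abs_nonneg _).trans (h.bound θ hθ i)

theorem abs_log_sub_log_le (h : IsRegularAt f u v b x) (huv : u < v) (hθ : θ ∈ Icc u v)
    (hθ' : θ' ∈ Icc u v) :
    |Real.log (f θ x) - Real.log (f θ' x)| ≤ b 1 x * |θ - θ'| := by
  have := abs_iteratedDerivWithin_sub_le huv h.contDiffOn (i := 0) (by norm_num)
    (fun θ hθ => h.bound θ hθ 1) hθ hθ'
  simpa only [iteratedDerivWithin_zero] using this

theorem abs_score_sub_linear_le (h : IsRegularAt f u v b x) (huv : u < v) (hθ₀ : θ₀ ∈ Icc u v)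
    (hθ : θ ∈ Icc u v) :
    |logDensityDeriv f (Icc u v) 1 θ x - logDensityDeriv f (Icc u v) 1 θ₀ x -
      logDensityDeriv f (Icc u v) 2 θ₀ x * (θ - θ₀)| ≤ b 3 x * (θ - θ₀) ^ 2 :=
  abs_deriv_sub_linear_le huv h.contDiffOn (fun θ hθ => h.bound θ hθ 3) hθ₀ hθ

theorem abs_log_sub_quadratic_le (h : IsRegularAt f u v b x) (huv : u < v) (hθ₀ : θ₀ ∈ Icc u v)
    (hθ : θ ∈ Icc u v) :
    |Real.log (f θ x) - Real.log (f θ₀ x) - (logDensityDeriv f (Icc u v) 1 θ₀ x * (θ - θ₀) +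
      logDensityDeriv f (Icc u v) 2 θ₀ x * (θ - θ₀) ^ 2 / 2)| ≤ b 3 x * |θ - θ₀| ^ 3 :=
  abs_sub_quadratic_le huv h.contDiffOn (fun θ hθ => h.bound θ hθ 3) hθ₀ hθ

theorem hasDerivAt_logDensityDeriv (h : IsRegularAt f u v b x) {i : ℕ} (hi : i < 3)
    (hθ : θ ∈ Ioo u v) :
    HasDerivAt (fun t => logDensityDeriv f (Icc u v) i t x)
      (logDensityDeriv f (Icc u v) (i + 1) θ x) θ :=
  (hasDerivWithinAt_iteratedDerivWithin (hθ.1.trans hθ.2) h.contDiffOn hi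
    (Ioo_subset_Icc_self hθ)).hasDerivAt (Icc_mem_nhds hθ.1 hθ.2)

end IsRegularAt

theorem logDensityDeriv_zero {S : Type*} (f : ℝ → S → ℝ) (Θ : Set ℝ) (θ : ℝ) (x : S) :
    logDensityDeriv f Θ 0 θ x = Real.log (f θ x) := by
  simp [logDensityDeriv]

/-- A family of functions on the interval `[u, v]` that is regular almost everywhere, with
square-integrable dominating functions, and whose expected logarithm has a unique maximum at the
interior point `θ₀`, with non-vanishing expected second derivative. -/
structure IsRegularModel {S : Type*} [MeasurableSpace S] (ν : Measure S) (f : ℝ → S → ℝ)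
    (u v θ₀ : ℝ) (b : Fin 4 → S → ℝ) : Prop where
  measurable : ∀ θ ∈ Icc u v, Measurable (f θ)
  mem : θ₀ ∈ Ioo u v
  regular : ∀ᵐ x ∂ν, IsRegularAt f u v b x
  memLp_bound : ∀ i, MemLp (b i) 2 ν
  integral_log_lt : ∀ θ ∈ Icc u v, θ ≠ θ₀ →
    ∫ x, Real.log (f θ x) ∂ν < ∫ x, Real.log (f θ₀ x) ∂ν
  curvature_ne_zero : ∫ x, logDensityDeriv f (Icc u v) 2 θ₀ x ∂ν ≠ 0

namespace IsRegularModel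

variable {S : Type*} [MeasurableSpace S] {ν : Measure S} [IsProbabilityMeasure ν]
  {f : ℝ → S → ℝ} {u v θ₀ : ℝ} {b : Fin 4 → S → ℝ}

omit [IsProbabilityMeasure ν] in
theorem lt (h : IsRegularModel ν f u v θ₀ b) : u < v := h.mem.1.trans h.mem.2

omit [IsProbabilityMeasure ν] in
theorem mem_Icc (h : IsRegularModel ν f u v θ₀ b) : θ₀ ∈ Icc u v := Ioo_subset_Icc_self h.mem

omit [IsProbabilityMeasure ν] in
theorem memLp_log (h : IsRegularModel ν f u v θ₀ b) {θ : ℝ} (hθ : θ ∈ Icc u v) :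
    MemLp (fun x => Real.log (f θ x)) 2 ν := by
  refine (h.memLp_bound 0).mono' (h.measurable θ hθ).log.aestronglyMeasurable ?_
  filter_upwards [h.regular] with x hx
  simpa [logDensityDeriv_zero] using hx.bound θ hθ 0

omit [IsProbabilityMeasure ν] in
-- Derivatives are almost everywhere limits of difference quotients along a sequence. The induction
-- runs over all of the open interval because a quotient at `θ` also uses the previous derivative at
-- nearby points.
theorem aemeasurable_logDensityDeriv (h : IsRegularModel ν f u v θ₀ b) {i : ℕ} (hi : i < 4) :
    ∀ θ ∈ Ioo u v, AEMeasurable (logDensityDeriv f (Icc u v) i θ) ν := by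
  induction i with
  | zero =>
    intro θ hθ
    simp only [funext (logDensityDeriv_zero f (Icc u v) θ)]
    exact (h.measurable θ (Ioo_subset_Icc_self hθ)).log.aemeasurable
  | succ i ih =>
    intro θ hθ
    obtain ⟨t, -, htm, htl⟩ := exists_seq_strictAnti_tendsto' hθ.2
    have htI : ∀ n, t n ∈ Ioo u v := fun n => ⟨hθ.1.trans (htm n).1, (htm n).2⟩
    have htl' : Tendsto t atTop (𝓝[≠] θ) :=
      tendsto_nhdsWithin_iff.2 ⟨htl, Eventually.of_forall fun n => (htm n).1.ne'⟩
    refine aemeasurable_of_tendsto_metrizable_ae' (f := fun n x =>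
      slope (fun s => logDensityDeriv f (Icc u v) i s x) θ (t n)) (fun n => ?_) ?_
    · simp only [slope_def_field]
      exact ((ih (by omega) _ (htI n)).sub (ih (by omega) _ hθ)).div_const _
    · filter_upwards [h.regular] with x hx
      exact ((hasDerivAt_iff_tendsto_slope.1
        (hx.hasDerivAt_logDensityDeriv (by omega) hθ))).comp htl'

omit [IsProbabilityMeasure ν] in
theorem memLp_logDensityDeriv (h : IsRegularModel ν f u v θ₀ b) (i : Fin 4) :
    MemLp (logDensityDeriv f (Icc u v) i θ₀) 2 ν := by
  refine (h.memLp_bound i).mono'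
    (h.aemeasurable_logDensityDeriv i.2 θ₀ h.mem).aestronglyMeasurable ?_
  filter_upwards [h.regular] with x hx using hx.bound θ₀ h.mem_Icc i

omit [IsProbabilityMeasure ν] in
theorem memLp_score (h : IsRegularModel ν f u v θ₀ b) :
    MemLp (logDensityDeriv f (Icc u v) 1 θ₀) 2 ν := h.memLp_logDensityDeriv 1

omit [IsProbabilityMeasure ν] in
theorem memLp_curvature (h : IsRegularModel ν f u v θ₀ b) :
    MemLp (logDensityDeriv f (Icc u v) 2 θ₀) 2 ν := h.memLp_logDensityDeriv 2

omit [IsProbabilityMeasure ν] in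
theorem integral_bound_nonneg (h : IsRegularModel ν f u v θ₀ b) (i : Fin 4) :
    0 ≤ ∫ x, b i x ∂ν :=
  integral_nonneg_of_ae (by filter_upwards [h.regular] with x hx using hx.nonneg h.mem_Icc i)

/-- Second order expansion of the expected log-density. -/
theorem abs_integral_log_sub_quadratic_le (h : IsRegularModel ν f u v θ₀ b) {θ : ℝ}
    (hθ : θ ∈ Icc u v) :
    |(∫ x, Real.log (f θ x) ∂ν) - (∫ x, Real.log (f θ₀ x) ∂ν) -
      ((∫ x, logDensityDeriv f (Icc u v) 1 θ₀ x ∂ν) * (θ - θ₀) +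
      (∫ x, logDensityDeriv f (Icc u v) 2 θ₀ x ∂ν) * (θ - θ₀) ^ 2 / 2)| ≤
      (∫ x, b 3 x ∂ν) * |θ - θ₀| ^ 3 := by
  have i0 := (h.memLp_log hθ).integrable one_le_two
  have i0' := (h.memLp_log h.mem_Icc).integrable one_le_two
  have i1 := (h.memLp_score.integrable one_le_two).mul_const (θ - θ₀)
  have i2 := ((h.memLp_curvature.integrable one_le_two).mul_const
    ((θ - θ₀) ^ 2)).div_const 2
  have i3 := ((h.memLp_bound 3).integrable one_le_two).mul_const (|θ - θ₀| ^ 3)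
  have i4 : Integrable (fun x => Real.log (f θ x) - Real.log (f θ₀ x)) ν := i0.sub i0'
  have i5 : Integrable (fun x => logDensityDeriv f (Icc u v) 1 θ₀ x * (θ - θ₀) +
    logDensityDeriv f (Icc u v) 2 θ₀ x * (θ - θ₀) ^ 2 / 2) ν := i1.add i2
  rw [← integral_mul_const, ← integral_mul_const, ← integral_div, ← integral_mul_const,
    ← integral_add i1 i2, ← integral_sub i0 i0', ← integral_sub i4 i5]
  refine abs_integral_le_integral_abs.trans (integral_mono_ae
    (i4.sub i5).abs i3 ?_)
  filter_upwards [h.regular] with x hx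
  exact hx.abs_log_sub_quadratic_le h.lt h.mem_Icc hθ

/-- The expected log-density is maximal at the interior point `θ₀`, so its second-order expansion
can exceed zero only by the cubic remainder. -/
theorem eventually_quadratic_nonpos (h : IsRegularModel ν f u v θ₀ b) :
    ∀ᶠ t : ℝ in 𝓝 0, (∫ x, logDensityDeriv f (Icc u v) 1 θ₀ x ∂ν) * t +
      (∫ x, logDensityDeriv f (Icc u v) 2 θ₀ x ∂ν) * t ^ 2 / 2 ≤ (∫ x, b 3 x ∂ν) * |t| ^ 3 := by
  have hev : ∀ᶠ t : ℝ in 𝓝 0, θ₀ + t ∈ Icc u v := by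
    have hc : Tendsto (fun t : ℝ => θ₀ + t) (𝓝 0) (𝓝 θ₀) := by
      have : ContinuousAt (fun t : ℝ => θ₀ + t) 0 := by fun_prop
      simpa [ContinuousAt] using this
    exact hc (Icc_mem_nhds h.mem.1 h.mem.2)
  filter_upwards [hev] with t ht
  have h1 := abs_le.1 (h.abs_integral_log_sub_quadratic_le ht)
  have h2 : ∫ x, Real.log (f (θ₀ + t) x) ∂ν ≤ ∫ x, Real.log (f θ₀ x) ∂ν := by
    by_cases h0 : θ₀ + t = θ₀
    · rw [h0]
    · exact (h.integral_log_lt _ ht h0).le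
  rw [add_sub_cancel_left] at h1
  linarith [h1.1]

end IsRegularModel

/-! ### First- and second-order conditions at the true parameter -/

theorem nonpos_of_eventually_quadratic_le {p q r : ℝ}
    (h : ∀ᶠ t : ℝ in 𝓝 0, p * t + q * t ^ 2 / 2 ≤ r * |t| ^ 3) : p ≤ 0 := by
  have h1 : ∀ᶠ t : ℝ in 𝓝[>] 0, p ≤ r * t ^ 2 - q * t / 2 := by
    filter_upwards [h.filter_mono nhdsWithin_le_nhds, self_mem_nhdsWithin] with t ht htp
    have htp : 0 < t := htp
    rw [abs_of_pos htp] at ht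
    have : p * t ≤ (r * t ^ 2 - q * t / 2) * t := by nlinarith
    exact le_of_mul_le_mul_right this htp
  have h2 : Tendsto (fun t : ℝ => r * t ^ 2 - q * t / 2) (𝓝[>] 0) (𝓝 0) := by
    have : ContinuousAt (fun t : ℝ => r * t ^ 2 - q * t / 2) 0 := by fun_prop
    have := this.tendsto
    simp only [ne_eq, OfNat.ofNat_ne_zero, not_false_eq_true, zero_pow, mul_zero, zero_div,
      sub_zero] at this
    exact this.mono_left nhdsWithin_le_nhds
  exact ge_of_tendsto h2 h1

/-- Dividing by `t > 0` and letting `t → 0` gives `p ≤ 0`; the reflection `t ↦ -t` gives the other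
sign. With `p = 0`, division by `t ^ 2` handles `q`. -/
theorem eq_zero_and_nonpos_of_eventually_quadratic_le {p q r : ℝ}
    (h : ∀ᶠ t : ℝ in 𝓝 0, p * t + q * t ^ 2 / 2 ≤ r * |t| ^ 3) : p = 0 ∧ q ≤ 0 := by
  have hneg : ∀ᶠ t : ℝ in 𝓝 0, (-p) * t + q * t ^ 2 / 2 ≤ r * |t| ^ 3 := by
    have hc : Tendsto (fun t : ℝ => -t) (𝓝 0) (𝓝 0) := by
      simpa using (continuous_neg (G := ℝ)).tendsto 0
    filter_upwards [hc.eventually h] with t ht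
    rw [abs_neg, neg_sq] at ht
    linarith
  have hp : p = 0 := le_antisymm (nonpos_of_eventually_quadratic_le h)
    (by linarith [nonpos_of_eventually_quadratic_le hneg])
  refine ⟨hp, ?_⟩
  have h1 : ∀ᶠ t : ℝ in 𝓝[>] 0, q ≤ 2 * r * t := by
    filter_upwards [h.filter_mono nhdsWithin_le_nhds, self_mem_nhdsWithin] with t ht htp
    have htp : 0 < t := htp
    rw [abs_of_pos htp, hp] at ht
    have : q * t ^ 2 ≤ (2 * r * t) * t ^ 2 := by nlinarith
    exact le_of_mul_le_mul_right this (by positivity)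
  have h2 : Tendsto (fun t : ℝ => 2 * r * t) (𝓝[>] 0) (𝓝 0) := by
    have : ContinuousAt (fun t : ℝ => 2 * r * t) 0 := by fun_prop
    have := this.tendsto
    rw [mul_zero] at this
    exact this.mono_left nhdsWithin_le_nhds
  exact ge_of_tendsto h2 h1

namespace IsRegularModel

variable {S : Type*} [MeasurableSpace S] {ν : Measure S} [IsProbabilityMeasure ν]
  {f : ℝ → S → ℝ} {u v θ₀ : ℝ} {b : Fin 4 → S → ℝ}

/-- This is the first-order condition at an interior maximum; the normalization of the densities is
not differentiated under the integral. -/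
theorem integral_score_eq_zero (h : IsRegularModel ν f u v θ₀ b) :
    ∫ x, logDensityDeriv f (Icc u v) 1 θ₀ x ∂ν = 0 :=
  (eq_zero_and_nonpos_of_eventually_quadratic_le h.eventually_quadratic_nonpos).1

theorem integral_curvature_neg (h : IsRegularModel ν f u v θ₀ b) :
    ∫ x, logDensityDeriv f (Icc u v) 2 θ₀ x ∂ν < 0 :=
  lt_of_le_of_ne (eq_zero_and_nonpos_of_eventually_quadratic_le h.eventually_quadratic_nonpos).2
    h.curvature_ne_zero

/-! ### The log-likelihood ratio outside rare events -/

variable {Ω : Type*} [MeasurableSpace Ω] {P : Measure Ω} [IsProbabilityMeasure P]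
  {X : ℕ → Ω → S}

omit [IsProbabilityMeasure ν] [IsProbabilityMeasure P] in
theorem rare_not_regular (h : IsRegularModel ν f u v θ₀ b) (hX : IsIIDSample P X ν) :
    Rare P (fun _ => {ω | ¬ ∀ n, IsRegularAt f u v b (X n ω)}) :=
  Rare.of_ae (by filter_upwards [hX.ae_forall h.regular] with ω hω using not_not.2 hω)

/-- Away from `θ₀` the likelihood exceeds the likelihood at `θ₀` only on rare events. -/
theorem rare_far (h : IsRegularModel ν f u v θ₀ b) (hX : IsIIDSample P X ν) {δ : ℝ}
    (hδ : 0 < δ) :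
    Rare P (fun N => {ω | ∃ θ ∈ Icc u v ∩ {θ | δ ≤ |θ - θ₀|},
      0 ≤ empMean X (fun x => Real.log (f θ x) - Real.log (f θ₀ x)) N ω}) := by
  have hK : IsCompact (Icc u v ∩ {θ | δ ≤ |θ - θ₀|}) :=
    isCompact_Icc.inter_right (isClosed_le continuous_const (by fun_prop))
  -- Rarity passes to subsets and finite unions, so by compactness a neighbourhood of each point
  -- suffices.
  refine hK.induction_on (p := fun K => Rare P (fun N => {ω | ∃ θ ∈ K,
      0 ≤ empMean X (fun x => Real.log (f θ x) - Real.log (f θ₀ x)) N ω})) ?_ ?_ ?_ ?_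
  · simpa using Rare.of_ae (P := P) (s := ∅) (by simp)
  · intro s t hst ht
    exact ht.mono fun N ω ⟨θ, hθ, h0⟩ => ⟨θ, hst hθ, h0⟩
  · intro s t hs ht
    refine (hs.union ht).mono fun N ω ⟨θ, hθ, h0⟩ => ?_
    rcases hθ with hθ | hθ
    · exact Or.inl ⟨θ, hθ, h0⟩
    · exact Or.inr ⟨θ, hθ, h0⟩
  · intro θ₁ hθ₁
    have hne : θ₁ ≠ θ₀ := by
      rintro rfl
      have : δ ≤ |θ₁ - θ₁| := hθ₁.2
      simp at this
      linarith
    have hmem : MemLp (fun x => Real.log (f θ₁ x) - Real.log (f θ₀ x)) 2 ν :=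
      (h.memLp_log hθ₁.1).sub (h.memLp_log h.mem_Icc)
    set M : ℝ := ∫ x, b 1 x ∂ν with hM
    have hM0 : 0 ≤ M := h.integral_bound_nonneg 1
    set m : ℝ := ∫ x, (Real.log (f θ₁ x) - Real.log (f θ₀ x)) ∂ν with hm
    have hmneg : m < 0 := by
      rw [hm, integral_sub ((h.memLp_log hθ₁.1).integrable one_le_two)
        ((h.memLp_log h.mem_Icc).integrable one_le_two)]
      exact sub_neg.2 (h.integral_log_lt _ hθ₁.1 hne)
    -- On the ball the mean ratio varies by at most `(M + 1) * r = -m / 4`, while at its centre it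
    -- is below `m / 2`; it therefore stays below `m / 4 < 0`.
    set r : ℝ := -m / (4 * (M + 1)) with hr
    have hr0 : 0 < r := div_pos (by linarith) (by linarith)
    refine ⟨(Icc u v ∩ {θ | δ ≤ |θ - θ₀|}) ∩ Metric.ball θ₁ r,
      inter_mem_nhdsWithin _ (Metric.ball_mem_nhds _ hr0), ?_⟩
    refine (((hX.rare_deviation hmem (ε := -m / 2) (by linarith)).union
      (hX.rare_deviation (h.memLp_bound 1) one_pos)).union (h.rare_not_regular hX)).mono
      fun N ω ⟨θ, hθ, h0⟩ => ?_
    by_contra hcon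
    simp only [mem_union, mem_ofPred_eq, not_or, not_le, not_not] at hcon
    obtain ⟨⟨h1, h2⟩, h3⟩ := hcon
    rw [← hm] at h1
    rw [← hM] at h2
    have hdist : |θ - θ₁| < r := hθ.2
    have h4 : |empMean X (fun x => Real.log (f θ x) - Real.log (f θ₁ x)) N ω| ≤
        empMean X (b 1) N ω * |θ - θ₁| :=
      abs_empMean_le fun n => (h3 n).abs_log_sub_log_le h.lt hθ.1.1 hθ₁.1
    have h5 : empMean X (fun x => Real.log (f θ x) - Real.log (f θ₀ x)) N ω =
        empMean X (fun x => Real.log (f θ x) - Real.log (f θ₁ x)) N ω +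
        empMean X (fun x => Real.log (f θ₁ x) - Real.log (f θ₀ x)) N ω := by
      rw [← empMean_add]; simp
    have h6 : empMean X (b 1) N ω * |θ - θ₁| ≤ (M + 1) * r :=
      mul_le_mul (by linarith [(abs_lt.1 h2).2]) hdist.le (abs_nonneg _) (by linarith)
    have h7 : (M + 1) * r = -m / 4 := by
      rw [hr]; field_simp
    linarith [(abs_le.1 h4).2, (abs_lt.1 h1).2]

omit [IsProbabilityMeasure ν] in
/-- Near `θ₀`, outside rare events, the mean log-likelihood ratio is close to a parabola and its
derivative to a line. -/
theorem exists_rare_near (h : IsRegularModel ν f u v θ₀ b) (hX : IsIIDSample P X ν) {η δ : ℝ}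
    (hη : 0 < η) (hδη : ((∫ x, b 3 x ∂ν) + 1) * δ ≤ η / 4) :
    ∃ B, Rare P B ∧ ∀ N, ∀ ω ∉ B N, ∀ t, θ₀ + t ∈ Icc u v → |t| ≤ δ →
      |empMean X (fun x => Real.log (f (θ₀ + t) x) - Real.log (f θ₀ x)) N ω -
        (empMean X (logDensityDeriv f (Icc u v) 1 θ₀) N ω * t -
          (-∫ x, logDensityDeriv f (Icc u v) 2 θ₀ x ∂ν) * t ^ 2 / 2)| ≤ η * t ^ 2 / 2 ∧
      |empMean X (logDensityDeriv f (Icc u v) 1 (θ₀ + t)) N ω -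
        (empMean X (logDensityDeriv f (Icc u v) 1 θ₀) N ω -
          (-∫ x, logDensityDeriv f (Icc u v) 2 θ₀ x ∂ν) * t)| ≤ η * |t| := by
  -- In the quadratic estimate, half of the tolerance `η * t ^ 2 / 2` pays for the deviation of the
  -- empirical second derivative and half for the Taylor remainder.
  refine ⟨_, ((hX.rare_deviation h.memLp_curvature (half_pos hη)).union
      (hX.rare_deviation (h.memLp_bound 3) one_pos)).union (h.rare_not_regular hX),
      fun N ω hω t ht htδ => ?_⟩
  simp only [mem_union, mem_ofPred_eq, not_or, not_le, not_not] at hω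
  obtain ⟨⟨h1, h2⟩, h3⟩ := hω
  set M : ℝ := ∫ x, b 3 x ∂ν with hM
  set q : ℝ := ∫ x, logDensityDeriv f (Icc u v) 2 θ₀ x ∂ν with hq
  set H : ℝ := empMean X (logDensityDeriv f (Icc u v) 2 θ₀) N ω with hH
  set s : ℝ := empMean X (logDensityDeriv f (Icc u v) 1 θ₀) N ω with hs
  have hM0 : 0 ≤ M := h.integral_bound_nonneg 3
  have h1 : |H - q| < η / 2 := h1
  have hBle : empMean X (b 3) N ω ≤ M + 1 := by linarith [(abs_lt.1 h2).2]
  have hBt : empMean X (b 3) N ω * |t| ≤ η / 4 :=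
    (mul_le_mul hBle htδ (abs_nonneg t) (by linarith)).trans hδη
  have hquad := abs_empMean_le (N := N) (X := X) (ω := ω) (h := b 3)
    (g := fun x => Real.log (f (θ₀ + t) x) - Real.log (f θ₀ x) -
      (logDensityDeriv f (Icc u v) 1 θ₀ x * (θ₀ + t - θ₀) +
        logDensityDeriv f (Icc u v) 2 θ₀ x * (θ₀ + t - θ₀) ^ 2 / 2)) fun n =>
    (h3 n).abs_log_sub_quadratic_le h.lt h.mem_Icc ht
  have hlin := abs_empMean_le (N := N) (X := X) (ω := ω) (h := b 3)
    (g := fun x => logDensityDeriv f (Icc u v) 1 (θ₀ + t) x -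
      logDensityDeriv f (Icc u v) 1 θ₀ x -
      logDensityDeriv f (Icc u v) 2 θ₀ x * (θ₀ + t - θ₀)) fun n =>
    (h3 n).abs_score_sub_linear_le h.lt h.mem_Icc ht
  simp only [add_sub_cancel_left] at hquad hlin
  constructor
  · have e : empMean X (fun x => Real.log (f (θ₀ + t) x) - Real.log (f θ₀ x) -
        (logDensityDeriv f (Icc u v) 1 θ₀ x * t +
          logDensityDeriv f (Icc u v) 2 θ₀ x * t ^ 2 / 2)) N ω =
        empMean X (fun x => Real.log (f (θ₀ + t) x) - Real.log (f θ₀ x)) N ω -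
          (s * t + H * (t ^ 2 / 2)) := by
      simp only [mul_div_assoc]
      rw [empMean_sub, empMean_add (g := fun x => logDensityDeriv f (Icc u v) 1 θ₀ x * t),
        empMean_mul_const, empMean_mul_const]
    rw [e] at hquad
    have h5 : empMean X (b 3) N ω * |t| ^ 3 ≤ η / 4 * t ^ 2 := by
      rw [← sq_abs t]
      nlinarith [sq_nonneg |t|]
    have h6 : |(H - q) * (t ^ 2 / 2)| ≤ η / 2 * (t ^ 2 / 2) := by
      rw [abs_mul, abs_of_nonneg (by positivity : 0 ≤ t ^ 2 / 2)]
      gcongr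
    have h7 := abs_le.1 hquad
    have h8 := abs_le.1 h6
    rw [abs_le]
    constructor <;> linarith [h7.1, h7.2, h8.1, h8.2]
  · have e : empMean X (fun x => logDensityDeriv f (Icc u v) 1 (θ₀ + t) x -
        logDensityDeriv f (Icc u v) 1 θ₀ x - logDensityDeriv f (Icc u v) 2 θ₀ x * t) N ω =
        empMean X (logDensityDeriv f (Icc u v) 1 (θ₀ + t)) N ω - s - H * t := by
      rw [empMean_sub, empMean_sub, empMean_mul_const]
    rw [e] at hlin
    have h5 : empMean X (b 3) N ω * t ^ 2 ≤ η / 4 * |t| := by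
      rw [← sq_abs t]
      nlinarith [abs_nonneg t]
    have h6 : |(H - q) * t| ≤ η / 2 * |t| := by
      rw [abs_mul]
      gcongr
    have h7 := abs_le.1 hlin
    have h8 := abs_le.1 h6
    have h9 : 0 ≤ η * |t| := by positivity
    rw [abs_le]
    constructor <;> linarith [h7.1, h7.2, h8.1, h8.2]

end IsRegularModel

/-! ### Likelihoods -/

section Likelihood

variable {S Ω : Type*} {X : ℕ → Ω → S} {f : ℝ → S → ℝ} {u v θ₀ θ : ℝ} {b : Fin 4 → S → ℝ}
  {N : ℕ} {ω : Ω}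

theorem likelihood_eq_exp (h : ∀ n, IsRegularAt f u v b (X n ω)) (hθ : θ ∈ Icc u v) :
    likelihood f (sample X N ω) θ =
      Real.exp (∑ i ∈ Finset.range N, Real.log (f θ (X i ω))) := by
  rw [Real.exp_sum, Finset.prod_range]
  exact Finset.prod_congr rfl fun i _ => (Real.exp_log ((h i).pos θ hθ)).symm

theorem empMean_nonneg_iff {g : S → ℝ} :
    0 ≤ empMean X g N ω ↔ 0 ≤ ∑ i ∈ Finset.range N, g (X i ω) := by
  unfold empMean
  rcases Nat.eq_zero_or_pos N with rfl | hN
  · simp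
  · have hN' : (0 : ℝ) < N := by exact_mod_cast hN
    rw [le_div_iff₀ hN', zero_mul]

theorem likelihood_le_iff (h : ∀ n, IsRegularAt f u v b (X n ω)) (hθ₀ : θ₀ ∈ Icc u v)
    (hθ : θ ∈ Icc u v) :
    likelihood f (sample X N ω) θ₀ ≤ likelihood f (sample X N ω) θ ↔
      0 ≤ empMean X (fun x => Real.log (f θ x) - Real.log (f θ₀ x)) N ω := by
  rw [empMean_nonneg_iff, likelihood_eq_exp h hθ₀, likelihood_eq_exp h hθ, Real.exp_le_exp,
    Finset.sum_sub_distrib, sub_nonneg]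

theorem one_le_likelihood_div_iff (h : ∀ n, IsRegularAt f u v b (X n ω)) (hθ₀ : θ₀ ∈ Icc u v)
    (hθ : θ ∈ Icc u v) :
    likelihood f (sample X N ω) θ / likelihood f (sample X N ω) θ₀ ≥ 1 ↔
      0 ≤ empMean X (fun x => Real.log (f θ x) - Real.log (f θ₀ x)) N ω := by
  rw [← likelihood_le_iff h hθ₀ hθ, ge_iff_le, one_le_div]
  rw [likelihood_eq_exp h hθ₀]
  exact Real.exp_pos _

/-- The mean score vanishes at an interior maximizer of the likelihood. -/
theorem empMean_score_eq_zero (h : ∀ n, IsRegularAt f u v b (X n ω)) (hθ : θ ∈ Ioo u v)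
    (hmax : IsMaxOn (likelihood f (sample X N ω)) (Icc u v) θ) :
    empMean X (logDensityDeriv f (Icc u v) 1 θ) N ω = 0 := by
  have hd : HasDerivAt (fun t => ∑ i ∈ Finset.range N, Real.log (f t (X i ω)))
      (∑ i ∈ Finset.range N, logDensityDeriv f (Icc u v) 1 θ (X i ω)) θ := by
    refine HasDerivAt.fun_sum fun i _ => ?_
    have := (h i).hasDerivAt_logDensityDeriv (i := 0) (by norm_num) hθ
    simpa only [logDensityDeriv_zero] using this
  have hloc : IsLocalMax (fun t => ∑ i ∈ Finset.range N, Real.log (f t (X i ω))) θ := by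
    filter_upwards [Icc_mem_nhds hθ.1 hθ.2] with t ht
    have := hmax ht
    simp only [mem_ofPred_eq] at this
    rwa [likelihood_eq_exp h ht, likelihood_eq_exp h (Ioo_subset_Icc_self hθ),
      Real.exp_le_exp] at this
  rw [empMean, hloc.hasDerivAt_eq_zero hd, zero_div]

end Likelihood

/-! ### Consistency and the limit of the true mean square error -/

namespace IsRegularModel

variable {S : Type*} [MeasurableSpace S] {ν : Measure S} [IsProbabilityMeasure ν]
  {f : ℝ → S → ℝ} {u v θ₀ : ℝ} {b : Fin 4 → S → ℝ}
  {Ω : Type*} [MeasurableSpace Ω] {P : Measure Ω} [IsProbabilityMeasure P] {X : ℕ → Ω → S}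

/-- Outside rare events, the mean log-likelihood ratio is negative away from `θ₀` and close to a
concave parabola near `θ₀`. -/
theorem exists_rare_parabola (h : IsRegularModel ν f u v θ₀ b) (hX : IsIIDSample P X ν) {η : ℝ}
    (hη : 0 < η) :
    ∃ δ B, 0 < δ ∧ u - θ₀ < -δ ∧ δ < v - θ₀ ∧ Rare P B ∧ ∀ N, ∀ ω ∉ B N,
      (∀ n, IsRegularAt f u v b (X n ω)) ∧
      (∀ t, θ₀ + t ∈ Icc u v → δ ≤ |t| →
        empMean X (fun x => Real.log (f (θ₀ + t) x) - Real.log (f θ₀ x)) N ω < 0) ∧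
      ∀ t, |t| ≤ δ →
        |empMean X (fun x => Real.log (f (θ₀ + t) x) - Real.log (f θ₀ x)) N ω -
          (empMean X (logDensityDeriv f (Icc u v) 1 θ₀) N ω * t -
            (-∫ x, logDensityDeriv f (Icc u v) 2 θ₀ x ∂ν) * t ^ 2 / 2)| ≤ η * t ^ 2 / 2 ∧
        |empMean X (logDensityDeriv f (Icc u v) 1 (θ₀ + t)) N ω -
          (empMean X (logDensityDeriv f (Icc u v) 1 θ₀) N ω -
            (-∫ x, logDensityDeriv f (Icc u v) 2 θ₀ x ∂ν) * t)| ≤ η * |t| := by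
  set M : ℝ := ∫ x, b 3 x ∂ν with hM
  have hM0 : 0 ≤ M := h.integral_bound_nonneg 3
  obtain ⟨hu, hv⟩ := h.mem
  -- The half distances keep the window strictly inside `[u, v]`, and the last term makes the Taylor
  -- remainder small relative to `η`.
  set δ : ℝ := min (min ((θ₀ - u) / 2) ((v - θ₀) / 2)) (η / (4 * (M + 1))) with hδ
  have hδ0 : 0 < δ := lt_min (lt_min (by linarith) (by linarith)) (by positivity)
  have hδu : δ ≤ (θ₀ - u) / 2 := (min_le_left _ _).trans (min_le_left _ _)
  have hδv : δ ≤ (v - θ₀) / 2 := (min_le_left _ _).trans (min_le_right _ _)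
  have hδη : (M + 1) * δ ≤ η / 4 := by
    have : δ ≤ η / (4 * (M + 1)) := min_le_right _ _
    rw [le_div_iff₀ (by positivity)] at this
    linarith
  obtain ⟨B, hB, hnear⟩ := h.exists_rare_near hX hη hδη
  refine ⟨δ, _, hδ0, by linarith, by linarith,
    (hB.union (h.rare_far hX hδ0)).union (h.rare_not_regular hX), fun N ω hω => ?_⟩
  simp only [mem_union, mem_ofPred_eq, not_or, not_not, not_exists, not_and, not_le] at hω
  obtain ⟨⟨h1, h2⟩, h3⟩ := hω
  refine ⟨h3, fun t ht hδt => h2 _ ⟨ht, ?_⟩, fun t ht => hnear N ω h1 t ?_ ht⟩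
  · simpa using hδt
  · have := abs_le.1 ht
    exact ⟨by linarith, by linarith⟩

omit [IsProbabilityMeasure ν] [IsProbabilityMeasure P] in
theorem iid_score (h : IsRegularModel ν f u v θ₀ b) (hX : IsIIDSample P X ν) :
    IIDSquareIntegrable P (fun n ω => logDensityDeriv f (Icc u v) 1 θ₀ (X n ω)) :=
  hX.iidSquareIntegrable h.memLp_score

omit [IsProbabilityMeasure P] in
theorem centredSum_score_div (h : IsRegularModel ν f u v θ₀ b) (hX : IsIIDSample P X ν) (N : ℕ)
    (ω : Ω) :
    centredSum P (fun n ω => logDensityDeriv f (Icc u v) 1 θ₀ (X n ω)) N ω / N =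
      empMean X (logDensityDeriv f (Icc u v) 1 θ₀) N ω := by
  simp only [centredSum, empMean]
  rw [hX.integral_comp h.memLp_score.aestronglyMeasurable, h.integral_score_eq_zero]
  simp

omit [IsProbabilityMeasure P] in
theorem variance_score (h : IsRegularModel ν f u v θ₀ b) (hX : IsIIDSample P X ν) :
    variance (fun ω => logDensityDeriv f (Icc u v) 1 θ₀ (X 0 ω)) P =
      ∫ x, (logDensityDeriv f (Icc u v) 1 θ₀ x) ^ 2 ∂ν := by
  rw [variance_of_integral_eq_zero (h.iid_score hX).memLp.aestronglyMeasurable.aemeasurable]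
  · exact hX.integral_comp (h.memLp_score.aestronglyMeasurable.pow 2) 0
  · rw [hX.integral_comp h.memLp_score.aestronglyMeasurable, h.integral_score_eq_zero]

variable {est : (N : ℕ) → (Fin N → S) → ℝ}

/-- Strong consistency of the maximum likelihood estimator. -/
theorem tendsto_mle (h : IsRegularModel ν f u v θ₀ b) (hX : IsIIDSample P X ν)
    (hest : IsMLE P X f (Icc u v) est) :
    ∀ᵐ ω ∂P, Tendsto (fun N => est N (sample X N ω)) atTop (𝓝 θ₀) := by
  -- Countably many radii allow one null set to serve every `ε`.
  have hfar : ∀ᵐ ω ∂P, ∀ k : ℕ, ∀ᶠ N in atTop, ω ∉ {ω | ∃ θ ∈ Icc u v ∩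
      {θ | 1 / ((k : ℝ) + 1) ≤ |θ - θ₀|},
      0 ≤ empMean X (fun x => Real.log (f θ x) - Real.log (f θ₀ x)) N ω} :=
    ae_all_iff.2 fun k => (h.rare_far hX Nat.one_div_pos_of_nat).2
  filter_upwards [hfar, hX.ae_forall h.regular, ae_all_iff.2 fun N => (hest N).2]
    with ω h1 h2 h3
  refine Metric.tendsto_atTop'.2 fun ε hε => ?_
  obtain ⟨k, hk⟩ := exists_nat_one_div_lt hε
  obtain ⟨N₀, hN₀⟩ := eventually_atTop.1 (h1 k)
  refine ⟨N₀, fun N hN => ?_⟩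
  obtain ⟨hmem, hmax⟩ := h3 N
  by_contra! hcon
  rw [Real.dist_eq] at hcon
  exact hN₀ N hN.le ⟨_, ⟨hmem, hk.le.trans hcon⟩,
    (likelihood_le_iff h2 h.mem_Icc hmem).1 (hmax h.mem_Icc)⟩

theorem measurable_sample (hX : ∀ n, Measurable (X n)) (N : ℕ) : Measurable (sample X N) :=
  measurable_pi_iff.2 fun i => hX i

theorem tendsto_mul_trueMSE (h : IsRegularModel ν f u v θ₀ b) (hX : IsIIDSample P X ν)
    (hest : IsMLE P X f (Icc u v) est) :
    Tendsto (fun N : ℕ => (N : ℝ) * trueMSE P X est θ₀ N) atTop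
      (𝓝 ((∫ x, (logDensityDeriv f (Icc u v) 1 θ₀ x) ^ 2 ∂ν) /
        (-∫ x, logDensityDeriv f (Icc u v) 2 θ₀ x ∂ν) ^ 2)) := by
  rw [← h.variance_score hX]
  refine (h.iid_score hX).tendsto_mul_integral_of_sandwich (D := (v - u) ^ 2)
    (neg_pos.2 h.integral_curvature_neg) (fun N => ?_) (fun N => ?_) fun η hη hηJ => ?_
  · exact ((((hest N).1.comp (measurable_sample hX.measurable N)).sub_const θ₀).pow_const
      2).aestronglyMeasurable
  · filter_upwards [(hest N).2] with ω hω
    refine ⟨sq_nonneg _, sq_le_sq' ?_ ?_⟩ <;>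
      linarith [hω.1.1, hω.1.2, h.mem.1, h.mem.2]
  · obtain ⟨δ, B, hδ, hu, hv, hB, hpar⟩ := h.exists_rare_parabola hX hη
    refine ⟨B, hB, fun N => ?_⟩
    filter_upwards [(hest N).2] with ω ⟨hmem, hmax⟩ hω
    obtain ⟨hreg, hfar, hnear⟩ := hpar N ω hω
    rw [h.centredSum_score_div hX]
    set t := est N (sample X N ω) - θ₀ with ht
    have hθ : est N (sample X N ω) = θ₀ + t := by rw [ht]; ring
    -- A maximizer does at least as well as `θ₀`, so it cannot lie where the ratio is negative. It
    -- is thus interior, and the score equation holds.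
    have htδ : |t| < δ := by
      by_contra! hcon
      have := hfar t (hθ ▸ hmem) hcon
      rw [← hθ] at this
      exact this.not_ge ((likelihood_le_iff hreg h.mem_Icc hmem).1 (hmax h.mem_Icc))
    have hb := abs_lt.1 htδ
    have hscore := empMean_score_eq_zero hreg
      (show est N (sample X N ω) ∈ Ioo u v from ⟨by linarith, by linarith⟩) hmax
    have hlin := (hnear t htδ.le).2
    rw [← hθ, hscore, zero_sub, abs_neg] at hlin
    exact sq_sandwich_of_abs_sub_le hη hηJ hlin

/-! ### The predicted mean square error -/

omit [IsProbabilityMeasure ν] [IsProbabilityMeasure P] in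
/-- A jointly measurable version of the mean log-likelihood ratio. -/
theorem exists_measurable_ratio (h : IsRegularModel ν f u v θ₀ b) (hX : IsIIDSample P X ν)
    (N : ℕ) :
    ∃ F : ℝ → Ω → ℝ, Measurable (Function.uncurry F) ∧ ∀ᵐ ω ∂P, ∀ t, θ₀ + t ∈ Icc u v →
      F t ω = empMean X (fun x => Real.log (f (θ₀ + t) x) - Real.log (f θ₀ x)) N ω := by
  set T : Set Ω := toMeasurable P {ω | ¬ ∀ n, IsRegularAt f u v b (X n ω)} with hT
  have hTm : MeasurableSet T := measurableSet_toMeasurable _ _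
  have hreg : ∀ ω ∉ T, ∀ n, IsRegularAt f u v b (X n ω) := fun ω hω => by
    by_contra hcon
    exact hω (subset_toMeasurable P _ hcon)
  have hTae : ∀ᵐ ω ∂P, ω ∉ T := by
    rw [ae_iff]
    simp only [not_not]
    change P T = 0
    rw [hT, measure_toMeasurable, ← ae_iff]
    exact hX.ae_forall h.regular
  -- Clamping the parameter to `[u, v]` and setting the ratio to zero on the exceptional set makes
  -- it continuous in `t` for every `ω`. Together with measurability in `ω` for fixed `t`, this
  -- gives joint measurability.
  set p : ℝ → ℝ := fun t => projIcc u v h.lt.le (θ₀ + t) with hp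
  have hpmem : ∀ t, p t ∈ Icc u v := fun t => Subtype.coe_prop _
  have hpc : Continuous p := by
    exact continuous_subtype_val.comp (continuous_projIcc.comp (by fun_prop))
  refine ⟨fun t => Tᶜ.indicator
    (empMean X (fun x => Real.log (f (p t) x) - Real.log (f θ₀ x)) N), ?_, ?_⟩
  · refine measurable_uncurry_of_continuous_of_measurable (fun ω => ?_) fun t => ?_
    · by_cases hω : ω ∈ T
      · simpa [hω] using continuous_const
      · simp only [mem_compl_iff, hω, not_false_eq_true, indicator_of_mem, empMean]
        refine (continuous_finsetSum _ fun i _ => ?_).div_const _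
        exact ((hreg ω hω i).contDiffOn.continuousOn.comp_continuous hpc hpmem).sub
          continuous_const
    · refine Measurable.indicator ?_ hTm.compl
      unfold empMean
      refine (Finset.measurable_sum _ fun i _ => ?_).div_const _
      exact (((h.measurable _ (hpmem t)).comp (hX.measurable i)).log).sub
        (((h.measurable _ h.mem_Icc).comp (hX.measurable i)).log)
  · filter_upwards [hTae] with ω hω t ht
    have hpt : p t = θ₀ + t := by simp only [hp, projIcc_of_mem h.lt.le ht]
    simp [hω, hpt]

omit [IsProbabilityMeasure ν] in
-- Fubini for the indicator of a random superlevel set weighted by `|ε|`: integrating first over `ω`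
-- gives the probabilities in the predicted error, integrating first over `ε` gives a random
-- variable comparable with the squared error.
theorem exists_predictedMSE_eq (h : IsRegularModel ν f u v θ₀ b) (hX : IsIIDSample P X ν)
    (N : ℕ) :
    IntervalIntegrable (predictedMSEIntegrand P X f θ₀ N) volume ((u - θ₀) / 2)
      ((v - θ₀) / 2) ∧
    ∃ F : ℝ → Ω → ℝ, (∀ ω, Measurable fun t => F t ω) ∧
      (∀ᵐ ω ∂P, ∀ t, θ₀ + t ∈ Icc u v →
        F t ω = empMean X (fun x => Real.log (f (θ₀ + t) x) - Real.log (f θ₀ x)) N ω) ∧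
      AEStronglyMeasurable (fun ω => ∫ ε in ((u - θ₀) / 2)..((v - θ₀) / 2),
        {ε | 0 ≤ F (2 * ε) ω}.indicator (|·|) ε) P ∧
      predictedMSE P X f u v θ₀ N =
        ∫ ω, (2 * ∫ ε in ((u - θ₀) / 2)..((v - θ₀) / 2),
          {ε | 0 ≤ F (2 * ε) ω}.indicator (|·|) ε) ∂P := by
  obtain ⟨F, hFm, hF⟩ := h.exists_measurable_ratio hX N
  have hle : (u - θ₀) / 2 ≤ (v - θ₀) / 2 := by linarith [h.lt]
  set κ : Measure ℝ := volume.restrict (Ioc ((u - θ₀) / 2) ((v - θ₀) / 2)) with hκ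
  set E : Set (ℝ × Ω) := {q | 0 ≤ F (2 * q.1) q.2} with hE
  have hEm : MeasurableSet E := measurableSet_le measurable_const
    (hFm.comp ((measurable_fst.const_mul 2).prodMk measurable_snd))
  set g : ℝ → Ω → ℝ := fun ε ω => {ε | 0 ≤ F (2 * ε) ω}.indicator (|·|) ε with hg
  have hgE : Function.uncurry g = E.indicator (fun q => |q.1|) := by
    ext ⟨ε, ω⟩
    simp [hg, hE, Function.uncurry, indicator_apply]
  have habs : Integrable (fun ε : ℝ => |ε|) κ := continuous_abs.integrableOn_Ioc
  have hgint : Integrable (Function.uncurry g) (κ.prod P) := by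
    rw [hgE]
    exact (habs.comp_fst P).indicator hEm
  have hinner : ∀ ε ∈ Ioc ((u - θ₀) / 2) ((v - θ₀) / 2),
      ∫ ω, g ε ω ∂P = predictedMSEIntegrand P X f θ₀ N ε := by
    intro ε hε
    have hmem : θ₀ + 2 * ε ∈ Icc u v := ⟨by linarith [hε.1], by linarith [hε.2]⟩
    have hsec : MeasurableSet {ω | 0 ≤ F (2 * ε) ω} := measurable_prodMk_left hEm
    have hgi : (fun ω => g ε ω) = {ω | 0 ≤ F (2 * ε) ω}.indicator (fun _ => |ε|) := by
      ext ω
      simp [hg, indicator_apply]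
    rw [hgi, integral_indicator_const _ hsec, smul_eq_mul, mul_comm, predictedMSEIntegrand]
    congr 1
    -- Almost sure agreement suffices, so the likelihood-ratio event itself need not be measurable.
    refine measureReal_congr ?_
    filter_upwards [hF, hX.ae_forall h.regular] with ω h1 h2
    refine propext ?_
    change 0 ≤ F (2 * ε) ω ↔ _
    rw [h1 _ hmem]
    exact (one_le_likelihood_div_iff h2 h.mem_Icc hmem).symm
  have hint : Integrable (predictedMSEIntegrand P X f θ₀ N) κ :=
    hgint.integral_prod_left.congr
      ((ae_restrict_iff' measurableSet_Ioc).2 (ae_of_all _ fun ε hε => hinner ε hε))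
  refine ⟨(intervalIntegrable_iff_integrableOn_Ioc_of_le hle).2 hint, F,
    fun ω => hFm.comp measurable_prodMk_right, hF, ?_, ?_⟩
  · simp only [intervalIntegral.integral_of_le hle]
    exact hgint.integral_prod_right.aestronglyMeasurable
  · rw [predictedMSE, integral_const_mul]
    congr 1
    simp only [intervalIntegral.integral_of_le hle]
    rw [← setIntegral_congr_fun measurableSet_Ioc hinner]
    exact integral_integral_swap hgint

/-- Outside rare events the inner integral obeys the same bounds in `s` as the squared error of the
maximizer, so the same sandwich yields the same limit. -/
theorem tendsto_mul_predictedMSE (h : IsRegularModel ν f u v θ₀ b) (hX : IsIIDSample P X ν) :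
    Tendsto (fun N : ℕ => (N : ℝ) * predictedMSE P X f u v θ₀ N) atTop
      (𝓝 ((∫ x, (logDensityDeriv f (Icc u v) 1 θ₀ x) ^ 2 ∂ν) /
        (-∫ x, logDensityDeriv f (Icc u v) 2 θ₀ x ∂ν) ^ 2)) := by
  have hle : (u - θ₀) / 2 ≤ (v - θ₀) / 2 := by linarith [h.lt]
  choose F hFm hF hFs hpred using fun N => (h.exists_predictedMSE_eq hX N).2
  rw [← h.variance_score hX]
  simp only [hpred]
  refine (h.iid_score hX).tendsto_mul_integral_of_sandwich
    (D := 2 * ∫ ε in ((u - θ₀) / 2)..((v - θ₀) / 2), |ε|)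
    (neg_pos.2 h.integral_curvature_neg) (fun N => ?_) (fun N => ?_) fun η hη hηJ => ?_
  · exact (hFs N).const_mul 2
  · refine ae_of_all _ fun ω => ?_
    have hEm : MeasurableSet {ε | 0 ≤ F N (2 * ε) ω} :=
      measurableSet_le measurable_const ((hFm N ω).comp (measurable_const_mul 2))
    simp only [intervalIntegral.integral_of_le hle]
    constructor
    · exact mul_nonneg zero_le_two (integral_nonneg fun ε =>
        indicator_nonneg (fun ε _ => abs_nonneg ε) ε)
    · refine mul_le_mul_of_nonneg_left (integral_mono ?_ continuous_abs.integrableOn_Ioc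
        fun ε => indicator_le_self' (fun ε _ => abs_nonneg ε) ε) zero_le_two
      exact Integrable.indicator continuous_abs.integrableOn_Ioc hEm
  · obtain ⟨δ, B, hδ, hu, hv, hB, hpar⟩ := h.exists_rare_parabola hX hη
    refine ⟨B, hB, fun N => ?_⟩
    filter_upwards [hF N] with ω hFω hω
    obtain ⟨-, hfar, hnear⟩ := hpar N ω hω
    rw [h.centredSum_score_div hX]
    refine superlevel_integral_sandwich (L := fun t => F N t ω) (hFm N ω) hδ hu hv hη hηJ
      (fun t ht hδt => ?_) fun t ht => ?_
    · have hmem : θ₀ + t ∈ Icc u v := ⟨by linarith [ht.1], by linarith [ht.2]⟩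
      rw [hFω t hmem]
      exact hfar t hmem hδt
    · have hb := abs_le.1 ht
      rw [hFω t ⟨by linarith, by linarith⟩]
      exact (hnear t ht).1

end IsRegularModel

/-! ### The statement for densities -/

section Density

variable {S : Type*} [MeasurableSpace S] {μ : Measure S} {f : ℝ → S → ℝ} {Θ : Set ℝ} {θ₀ θ : ℝ}

theorem klDensity_eq_integral_obsLaw (hf : IsDensityFamily μ f Θ) (hθ₀ : θ₀ ∈ Θ) :
    klDensity μ f θ₀ θ = ∫ x, Real.log (f θ₀ x / f θ x) ∂(obsLaw μ f θ₀) := by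
  rw [obsLaw, integral_withDensity_eq_integral_toReal_smul (hf.measurable θ₀ hθ₀).ennreal_ofReal
    (ae_of_all _ fun x => ENNReal.ofReal_lt_top)]
  simp only [klDensity, smul_eq_mul, ENNReal.toReal_ofReal (hf.nonneg θ₀ hθ₀ _)]

end Density

theorem proposition1
    {S Ω : Type*} [MeasurableSpace S] [MeasurableSpace Ω]
    (μ : Measure S) (f : ℝ → S → ℝ) (θmin θmax θ₀ : ℝ)
    (hf : IsDensityFamily μ f (Icc θmin θmax))
    -- the observations are i.i.d. with density `f θ₀`
    (P : Measure Ω) [IsProbabilityMeasure P] (X : ℕ → Ω → S)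
    (hXmeas : ∀ n, Measurable (X n))
    (hXindep : iIndepFun X P)
    (hXlaw : ∀ n, P.map (X n) = obsLaw μ f θ₀)
    -- A0: finite support, with the true value in the interior
    (hA0 : θ₀ ∈ Ioo θmin θmax)
    -- A1: `ln f(x; θ)` exists and is three times continuously differentiable in `θ`
    (hA1 : ∀ᵐ x ∂(obsLaw μ f θ₀), (∀ θ ∈ Icc θmin θmax, 0 < f θ x) ∧
      ContDiffOn ℝ 3 (fun θ => Real.log (f θ x)) (Icc θmin θmax))
    -- A2: domination by functions of finite variance
    (b : Fin 4 → S → ℝ)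
    (hb : ∀ i, MemLp (b i) 2 (obsLaw μ f θ₀))
    (hA2 : ∀ᵐ x ∂(obsLaw μ f θ₀), ∀ θ ∈ Icc θmin θmax, ∀ i : Fin 4,
      |logDensityDeriv f (Icc θmin θmax) i θ x| ≤ b i x)
    -- A3: unique minimum of the KL divergence at the true value
    (hA3 : ∀ θ ∈ Icc θmin θmax, θ ≠ θ₀ → klDensity μ f θ₀ θ₀ < klDensity μ f θ₀ θ)
    -- A4: the expected second derivative does not vanish
    (hA4 : ∫ x, logDensityDeriv f (Icc θmin θmax) 2 θ₀ x ∂(obsLaw μ f θ₀) ≠ 0)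
    -- the maximum likelihood estimator
    (est : (N : ℕ) → (Fin N → S) → ℝ)
    (hest : IsMLE P X f (Icc θmin θmax) est) :
    -- the integral in the predicted MSE converges
    (∀ N, IntervalIntegrable (predictedMSEIntegrand P X f θ₀ N) volume
      ((θmin - θ₀) / 2) ((θmax - θ₀) / 2)) ∧
    -- the estimator is strongly consistent
    (∀ᵐ ω ∂P, Tendsto (fun N => est N (sample X N ω)) atTop (𝓝 θ₀)) ∧
    -- predicted and true MSE agree in the large-sample limit, at the scale `1 / N`
    (∃ V : ℝ,
      Tendsto (fun N : ℕ => (N : ℝ) * trueMSE P X est θ₀ N) atTop (𝓝 V) ∧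
      Tendsto (fun N : ℕ => (N : ℝ) * predictedMSE P X f θmin θmax θ₀ N) atTop (𝓝 V)) ∧
    (0 < fisherInformation μ f (Icc θmin θmax) θ₀ →
      Tendsto (fun N : ℕ => predictedMSE P X f θmin θmax θ₀ N / trueMSE P X est θ₀ N)
        atTop (𝓝 1)) ∧
    -- under asymptotic efficiency the predicted MSE is asymptotically the CRLB
    (AsymptoticallyEfficient μ P X f (Icc θmin θmax) est θ₀ →
      Tendsto (fun N : ℕ => (N : ℝ) * predictedMSE P X f θmin θmax θ₀ N) atTop
        (𝓝 (fisherInformation μ f (Icc θmin θmax) θ₀)⁻¹)) := by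
  set ν := obsLaw μ f θ₀ with hν
  have hX : IsIIDSample P X ν := ⟨hXmeas, hXindep, hXlaw⟩
  have : IsProbabilityMeasure ν := by
    rw [← hXlaw 0]
    exact Measure.isProbabilityMeasure_map (hXmeas 0).aemeasurable
  have hmem : θ₀ ∈ Icc θmin θmax := Ioo_subset_Icc_self hA0
  have hreg : ∀ᵐ x ∂ν, IsRegularAt f θmin θmax b x := by
    filter_upwards [hA1, hA2] with x h1 h2 using ⟨h1.1, h1.2, h2⟩
  have hlog : ∀ θ ∈ Icc θmin θmax, Integrable (fun x => Real.log (f θ x)) ν := by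
    intro θ hθ
    refine ((hb 0).integrable one_le_two).mono'
      (hf.measurable θ hθ).log.aestronglyMeasurable ?_
    filter_upwards [hreg] with x hx
    simpa [logDensityDeriv_zero] using hx.bound θ hθ 0
  -- Integrability of both logarithms, from `b 0`, splits the divergence, so its unique minimum
  -- becomes a unique maximum of the expected log-density.
  have hkl : ∀ θ ∈ Icc θmin θmax, klDensity μ f θ₀ θ =
      (∫ x, Real.log (f θ₀ x) ∂ν) - ∫ x, Real.log (f θ x) ∂ν := by
    intro θ hθ
    rw [klDensity_eq_integral_obsLaw hf hmem, ← integral_sub (hlog _ hmem) (hlog θ hθ)]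
    refine integral_congr_ae ?_
    filter_upwards [hreg] with x hx
    exact Real.log_div (hx.pos _ hmem).ne' (hx.pos _ hθ).ne'
  have h : IsRegularModel ν f θmin θmax θ₀ b :=
    { measurable := hf.measurable
      mem := hA0
      regular := hreg
      memLp_bound := hb
      integral_log_lt := fun θ hθ hne => by
        have := hA3 θ hθ hne
        rw [hkl θ hθ, hkl θ₀ hmem] at this
        linarith
      curvature_ne_zero := hA4 }
  have htrue := h.tendsto_mul_trueMSE hX hest
  have hpred := h.tendsto_mul_predictedMSE hX
  refine ⟨fun N => (h.exists_predictedMSE_eq hX N).1, h.tendsto_mle hX hest,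
    ⟨_, htrue, hpred⟩, fun hI => ?_, fun hE => ?_⟩
  · have hV : 0 < (∫ x, (logDensityDeriv f (Icc θmin θmax) 1 θ₀ x) ^ 2 ∂ν) /
        (-∫ x, logDensityDeriv f (Icc θmin θmax) 2 θ₀ x ∂ν) ^ 2 :=
      div_pos hI (pow_pos (neg_pos.2 h.integral_curvature_neg) 2)
    have hdiv := hpred.div htrue hV.ne'
    rw [div_self hV.ne'] at hdiv
    refine hdiv.congr' ?_
    filter_upwards [eventually_gt_atTop 0] with N hN
    exact mul_div_mul_left _ _ (by exact_mod_cast hN.ne')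
  -- Efficiency serves only to name the limit already shared by the two errors.
  · rw [← tendsto_nhds_unique htrue hE.2]
    exact hpred
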